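/- Let $\alpha>\omega>0$ and let $s\in\{1,-1\}$. For an integer $n\ge 0$ and $E\in\mathbb R$ put $k_n(E)=\sqrt{2E-(2n+1)\omega}$ and $$v_n(x,E)=\rho_n(E)\cos\bigl(k_n(E)(|x|-\pi)\bigr),\qquad \rho_n(E)=\Bigl(\pi+\frac{\sin(2k_n(E)\pi)}{2k_n(E)}\Bigr)^{-1/2}$$ (with hyperbolic functions of $\chi_n=-ik_n$ in place of circular functions of $k_n$ when $k_n$ is imaginary). Put $$h_2(n,E)=\alpha\sqrt{n+2}\,v_{n+2}(0,E),\quad h_1(n,E)=(2\omega)^{1/2}v'_{n+1}(0+,E)\quad(n\ge -1),\qquad h_0(n,E)=\alpha\sqrt{n+1}\,v_n(0,E)\quad(n\ge 0),$$ where the prime is the derivative in $x$, and consider the recurrence $$h_2(n,E)\,C(n+2)+s\,h_1(n,E)\,C(n+1)+h_0(n,E)\,C(n)=0\qquad(n\ge 0)\tag{1}$$ with the initial condition $$h_2(-1,E)\,C(1)=-s\,h_1(-1,E)\,C(0).\tag{2}$$ (The two signs are exchanged by $C(n)\mapsto(-1)^nC(n)$.) An energy $E\in\mathbb R$ is called exceptional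 if $h_2(n,E)=0$ or $h_0(n,E)=0$ for some $n\ge 0$, or if $E=(n+\frac12)\omega$ for some integer $n\ge 0$. Put $$\theta=\arccos(s\,\omega/\alpha),\qquad \lambda=\frac1{2\sqrt{\alpha^2-\omega^2}}.$$ (i) For every non-exceptional $E$ there are unique solutions $C^\star_+(\cdot,E)$ and $C^\star_-(\cdot,E)$ of (1), the normal solutions, with $$C^\star_\pm(n,E)=\frac1{\sqrt n}\exp\bigl(\pm i(n\theta+s\lambda E\log n)\bigr)+O(n^{-3/2})\qquad(n\to\infty),$$ and they are linearly independent. For every $n\ge 0$, the functions $E\mapsto C^\star_\pm(n,E)$ are of class $C^1$ on every closed interval that contains no exceptional energy. (ii) There are functions $Z:\mathbb R\to\mathbb C$ and $\zeta:\mathbb R\to\mathbb R$, both of class $C^1$ on every closed interval that contains no exceptional energy, such that for every non-exceptional $E$ one has $Z(E)=|Z(E)|e^{i\zeta(E)}$ and (1) has a real solution $C(\cdot,E)$ that satisfies (2), with $C(0,E)>0$, $C(0,E)\,|Z(E)|=\pi^{-1/2}$, $C(n,E)=C(0,E)\,\mathrm{Re}\{Z(E)\,C^\star_+(n,E)\}$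 for all $n\ge 0$, and $$C(n,E)=\frac1{\sqrt{\pi n}}\cos\bigl(n\theta+s\lambda E\log n+\zeta(E)\bigr)+O(n^{-3/2})\qquad(n\to\infty).$$ -/

import Mathlib

namespace OscillatorRing

noncomputable section

/-- `k_n(E)² = 2E - (2n+1)ω`; it is negative for `n > E/ω - 1/2`. -/
def waveNumberSq (ω : ℝ) (n : ℤ) (E : ℝ) : ℝ :=
  2 * E - (2 * (n : ℝ) + 1) * ω

/-- The normalized functions `v_n(x,E) = ρ_n(E) cos (k_n(E) (|x| - π))` on `[-π, π]`, where
`ρ_n(E) = (π + sin (2 k_n π) / (2 k_n))^(-1/2)`. Where `k_n(E)` is imaginary, the circular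
functions are replaced by hyperbolic ones and `k_n` by `χ_n = -i k_n`. The threshold energies,
where `k_n(E) = 0`, are exceptional (see `exceptionalEnergies`). -/
def v (ω : ℝ) (n : ℤ) (E x : ℝ) : ℝ :=
  if 0 ≤ waveNumberSq ω n E then
    let k := √(waveNumberSq ω n E)
    (√(Real.pi + Real.sin (2 * k * Real.pi) / (2 * k)))⁻¹ * Real.cos (k * (|x| - Real.pi))
  else
    let χ := √(-waveNumberSq ω n E)
    (√(Real.pi + Real.sinh (2 * χ * Real.pi) / (2 * χ)))⁻¹ * Real.cosh (χ * (|x| - Real.pi))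

/-- `h₂(n,E) = α √(n+2) v_{n+2}(0,E)`, used for `n ≥ -1`. -/
def h₂ (α ω : ℝ) (n : ℤ) (E : ℝ) : ℝ :=
  α * √((n : ℝ) + 2) * v ω (n + 2) E 0

/-- `h₁(n,E) = (2ω)^{1/2} v'_{n+1}(0+,E)`, used for `n ≥ -1`; the derivative is the right
derivative in `x` at `x = 0`. -/
def h₁ (ω : ℝ) (n : ℤ) (E : ℝ) : ℝ :=
  √(2 * ω) * derivWithin (fun x => v ω (n + 1) E x) (Set.Ioi 0) 0

/-- `h₀(n,E) = α √(n+1) v_n(0,E)`, used for `n ≥ 0`. -/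
def h₀ (α ω : ℝ) (n : ℤ) (E : ℝ) : ℝ :=
  α * √((n : ℝ) + 1) * v ω n E 0

/-- The energies at which a leading or a trailing coefficient of the recurrence vanishes. -/
def singularEnergies (α ω : ℝ) : Set ℝ :=
  {E | ∃ n : ℕ, h₂ α ω n E = 0 ∨ h₀ α ω n E = 0}

/-- The exceptional energies: the singular ones and the thresholds `(n + 1/2) ω`. -/
def exceptionalEnergies (α ω : ℝ) : Set ℝ :=
  singularEnergies α ω ∪ {E | ∃ n : ℕ, E = ((n : ℝ) + 1 / 2) * ω}

/-- `C` solves `h₂(n,E) C(n+2) + s h₁(n,E) C(n+1) + h₀(n,E) C(n) = 0` for all `n ≥ 0`. -/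
def IsSolution (α ω s E : ℝ) (C : ℕ → ℂ) : Prop :=
  ∀ n : ℕ, (h₂ α ω n E : ℂ) * C (n + 2) + (s : ℂ) * (h₁ ω n E : ℂ) * C (n + 1)
    + (h₀ α ω n E : ℂ) * C n = 0

/-- The initial condition `h₂(-1,E) C(1) = - s h₁(-1,E) C(0)`. -/
def InitialCondition (α ω s E : ℝ) (C : ℕ → ℂ) : Prop :=
  (h₂ α ω (-1) E : ℂ) * C 1 = -((s : ℂ) * (h₁ ω (-1) E : ℂ) * C 0)

/-- `θ = arccos (s ω / α)`. -/
def θ (α ω s : ℝ) : ℝ := Real.arccos (s * ω / α)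

/-- `λ = 1 / (2 √(α² - ω²))`. -/
def lam (α ω : ℝ) : ℝ := 1 / (2 * √(α ^ 2 - ω ^ 2))

/-- The oscillating phase `n θ + s λ E log n`. -/
def phase (α ω s E : ℝ) (n : ℕ) : ℝ :=
  n * θ α ω s + s * lam α ω * E * Real.log n

/-- `C` is the normal solution with sign `τ = ±1`: it solves the recurrence and
`C(n) = n^{-1/2} exp (i τ (n θ + s λ E log n)) + O(n^{-3/2})` as `n → ∞`. -/
def IsNormalSolution (α ω s τ E : ℝ) (C : ℕ → ℂ) : Prop :=
  IsSolution α ω s E C ∧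
    (fun n : ℕ => C n - ((1 / √(n : ℝ) : ℝ) : ℂ) *
        Complex.exp (Complex.I * ((τ * phase α ω s E n : ℝ) : ℂ)))
      =O[Filter.atTop] fun n : ℕ => (n : ℝ) ^ (-(3 / 2) : ℝ)

end

end OscillatorRing

open OscillatorRing

/-! Once `n` is large, `k_n` is imaginary and `v_n(0) > 0`, so one may put `C(n) = (2ω)^{1/4} y(n) /
v_n(0)`. This leaves a reduced recurrence for `y` whose middle coefficient contains only `χ
tanh(πχ)`. Since `χ_m = √(2ωm) · √(1 + (1/2 - E/ω)/m)` and `1 - tanh` is exponentially small in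
`√m`, that coefficient is explicit up to a relative error `O(m⁻²)`. The trial functions `m^{-1/4 ±
iμE} e^{±imθ}` solve the reduced recurrence with relative residual `O(m⁻²)` exactly when `2ωμ sin θ
= cos θ`, that is, `μ = sλ` (`residual_isBigO`).

Variation of constants (`variation_of_constants`) turns this into a first-order system `X(n+1) = (1
+ M(n)) X(n)`. For complex `E` near the real axis `M(n)` is `O(n^{-3/2})`, hence summable, locally
uniformly and holomorphically in `E`. The infinite product (`exists_normalized_solution`) then gives
a solution holomorphic in `E` with `X → 1`, and holomorphy is the source of the `C¹` dependence. At
real `E` the sharper `M(n) = O(n⁻²)` gives the rate `1/n`. With `v_n(0) = (2ωn)^{1/4}(1 + O(1/n))`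
(`v_zero_isBigO`) this becomes the asserted asymptotics. Off the exceptional set the recurrence can
be run down to `n = 0`.

Uniqueness and independence come from a weighted Casoratian that is constant in `n`
(`casoratian_const`) and can be read off at infinity (`casoratian_eq_limit`): it is a nonzero
multiple of `sin θ` for the two normal solutions and zero against anything that is `o(n^{-1/2})`.
The coefficients are real, so conjugation exchanges the two normal solutions. Cramer's rule at `n =
0, 1` then yields `Z`, and `ζ` is a `C¹` argument of the nonvanishing `Z` (`exists_contDiff_arg`).
-/

/-! ### General tools: infinite products, linear recurrences, `C¹` arguments. -/

namespace OscillatorRing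
open Filter Topology Asymptotics

/-- The partial products of `1 + M` converge uniformly to a limit `L`, holomorphic by Weierstrass.
Starting far enough out keeps `L` within `1/2` of `1`, hence invertible, and multiplying on the
right by `L⁻¹` moves the normalization from the initial index to infinity. -/
theorem exists_normalized_solution {A : Type*} [NormedRing A] [NormedAlgebra ℂ A]
    [CompleteSpace A] {V : Set ℂ} (hV : IsOpen V) {M : ℕ → ℂ → A} {g : ℕ → ℝ} (hg : Summable g)
    (hg0 : ∀ n, 0 ≤ g n) {N : ℕ} (hM : ∀ n ≥ N, DifferentiableOn ℂ (M n) V)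
    (hb : ∀ n ≥ N, ∀ E ∈ V, ‖M n E‖ ≤ g n) :
    ∃ N' ≥ N, ∃ X : ℕ → ℂ → A, (∀ n, DifferentiableOn ℂ (X n) V) ∧
      (∀ n ≥ N', ∀ E ∈ V, X (n + 1) E = (1 + M n E) * X n E) ∧
      ∀ E ∈ V, Tendsto (fun n => X n E) atTop (𝓝 1) := by
  have htail : Tendsto (fun i => ‖(1 : A)‖ * (Real.exp (∑' k, g (k + i)) - 1)) atTop (𝓝 0) := by
    have h := (Real.continuous_exp.tendsto 0).comp (tendsto_sum_nat_add g)
    simpa using (h.sub_const 1).const_mul ‖(1 : A)‖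
  obtain ⟨N', hN', hsmall⟩ :=
    ((eventually_ge_atTop N).and (htail.eventually_lt_const (show (0 : ℝ) < 1 / 2 by norm_num))).exists
  set δ := ∑' k, g (k + N') with hδ
  have hgs : Summable fun k => g (k + N') := (summable_nat_add_iff N').2 hg
  let T : ℕ → ℂ → A := fun k E => Nat.rec 1 (fun k t => (1 + M (k + N') E) * t) k
  have T0 : ∀ E, T 0 E = 1 := fun E => rfl
  have Ts : ∀ k E, T (k + 1) E = (1 + M (k + N') E) * T k E := fun k E => rfl
  have hTd : ∀ k, DifferentiableOn ℂ (T k) V := by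
    intro k
    induction k with
    | zero => exact differentiableOn_const 1
    | succ k ih =>
      exact ((differentiableOn_const 1).add (hM _ (by omega))).mul ih
  -- A discrete Gronwall bound. The factor `‖1‖` is kept because the norm of the unit need not be
  -- one.
  have hT1 : ∀ E ∈ V, ∀ k, ‖T k E - 1‖ ≤ ‖(1 : A)‖ * (Real.exp (∑ i ∈ Finset.range k, g (i + N')) - 1) := by
    intro E hE k
    induction k with
    | zero => simp [T0]
    | succ k ih =>
      set S := ∑ i ∈ Finset.range k, g (i + N')
      rw [Finset.sum_range_succ, Real.exp_add]
      have e1 : T (k + 1) E - 1 = (T k E - 1) + M (k + N') E * ((T k E - 1) + 1) := by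
        rw [Ts]; noncomm_ring
      have h1 : ‖M (k + N') E‖ ≤ g (k + N') := hb _ (by omega) E hE
      have h2 : ‖T (k + 1) E - 1‖ ≤ ‖T k E - 1‖ + g (k + N') * (‖T k E - 1‖ + ‖(1 : A)‖) := by
        rw [e1]
        refine (norm_add_le _ _).trans (add_le_add_right ((norm_mul_le _ _).trans ?_) _)
        exact mul_le_mul h1 (norm_add_le _ _) (norm_nonneg _) (hg0 _)
      have h3 : 1 + g (k + N') ≤ Real.exp (g (k + N')) := by
        linarith [Real.add_one_le_exp (g (k + N'))]
      have h4 := hg0 (k + N')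
      calc _ ≤ (1 + g (k + N')) * ‖T k E - 1‖ + g (k + N') * ‖(1 : A)‖ := by linarith
        _ ≤ (1 + g (k + N')) * (‖(1 : A)‖ * (Real.exp S - 1)) + g (k + N') * ‖(1 : A)‖ := by
          gcongr
        _ = ‖(1 : A)‖ * (Real.exp S * (1 + g (k + N')) - 1) := by ring
        _ ≤ _ := by gcongr
  have hT2 : ∀ E ∈ V, ∀ k, ‖T k E - 1‖ ≤ ‖(1 : A)‖ * (Real.exp δ - 1) := by
    intro E hE k
    refine (hT1 E hE k).trans ?_
    gcongr
    exact hgs.sum_le_tsum _ (fun i _ => hg0 _)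
  set B := ‖(1 : A)‖ * (Real.exp δ - 1) + ‖(1 : A)‖
  have hT3 : ∀ E ∈ V, ∀ k, ‖T k E‖ ≤ B := fun E hE k => by
    calc ‖T k E‖ = ‖(T k E - 1) + 1‖ := by simp
      _ ≤ _ := (norm_add_le _ _).trans (add_le_add_left (hT2 E hE k) _)
  have hsum : ∀ E k, T k E = 1 + ∑ i ∈ Finset.range k, M (i + N') E * T i E := by
    intro E k
    induction k with
    | zero => simp [T0]
    | succ k ih =>
      rw [Finset.sum_range_succ, ← add_assoc, ← ih, Ts]; noncomm_ring
  let L : ℂ → A := fun E => 1 + ∑' i, M (i + N') E * T i E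
  have hunif : TendstoUniformlyOn T L atTop V := by
    have h := tendstoUniformlyOn_tsum_nat (f := fun i E => M (i + N') E * T i E)
      (hgs.mul_right B) (s := V) (fun n E hE => (norm_mul_le _ _).trans
        (mul_le_mul (hb _ (by omega) E hE) (hT3 E hE n) (norm_nonneg _) (hg0 _)))
    rw [Metric.tendstoUniformlyOn_iff] at h ⊢
    intro ε hε
    filter_upwards [h ε hε] with n hn E hE
    have := hn E hE
    rw [hsum]
    simpa [L] using this
  have hLd : DifferentiableOn ℂ L V :=
    hunif.tendstoLocallyUniformlyOn.differentiableOn (Eventually.of_forall hTd) hV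
  have hLu : ∀ E ∈ V, IsUnit (L E) := by
    intro E hE
    have h1 : ‖L E - 1‖ ≤ 1 / 2 :=
      le_of_tendsto (((hunif.tendsto_at hE).sub_const 1).norm)
        (Eventually.of_forall fun k => (hT2 E hE k).trans hsmall.le)
    have h2 : ‖1 - L E‖ < 1 := by rw [norm_sub_rev]; linarith
    simpa using isUnit_one_sub_of_norm_lt_one h2
  -- For `n < N'` the truncated difference is `0`, so these values are also holomorphic.
  refine ⟨N', hN', fun n E => T (n - N') E * Ring.inverse (L E), ?_, ?_, ?_⟩
  · intro n
    refine (hTd _).mul fun E hE => ?_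
    exact (((hLd E hE).differentiableAt (hV.mem_nhds hE)).inverse (hLu E hE)).differentiableWithinAt
  · intro n hn E hE
    obtain ⟨k, rfl⟩ := Nat.exists_eq_add_of_le' hn
    have : k + N' + 1 - N' = k + 1 := by omega
    simp only [this, Nat.add_sub_cancel, Ts, mul_assoc]
  · intro E hE
    have h := ((hunif.tendsto_at hE).comp (tendsto_sub_atTop_nat N')).mul_const (Ring.inverse (L E))
    rw [Ring.mul_inverse_cancel _ (hLu E hE)] at h
    exact h

/-- Sum the increments up to infinity; `1/m² ≤ 2(1/m - 1/(m+1))` makes the bound telescope. -/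
theorem isBigO_inv_of_isBigO_sub {F : Type*} [NormedAddCommGroup F] {x : ℕ → F} {l : F}
    (hx : Tendsto x atTop (𝓝 l))
    (h : (fun n => x (n + 1) - x n) =O[atTop] fun n : ℕ => ((n : ℝ) ^ 2)⁻¹) :
    (fun n => x n - l) =O[atTop] fun n : ℕ => (n : ℝ)⁻¹ := by
  obtain ⟨K, hK0, hK⟩ := h.exists_nonneg
  rw [IsBigOWith, eventually_atTop] at hK
  obtain ⟨N, hN⟩ := hK
  refine IsBigO.of_bound (2 * K) ?_
  filter_upwards [eventually_ge_atTop (N + 1)] with n hn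
  have step : ∀ m ≥ n, ‖x m - x n‖ ≤ 2 * K * ((n : ℝ)⁻¹ - (m : ℝ)⁻¹) := by
    intro m hm
    induction m, hm using Nat.le_induction with
    | base => simp
    | succ m hm ih =>
      have hm0 : (0 : ℝ) < m := by exact_mod_cast (show 0 < m by omega)
      have hm1 : (1 : ℝ) ≤ m := by exact_mod_cast (show 1 ≤ m by omega)
      have h1 : ‖x (m + 1) - x m‖ ≤ K * ((m : ℝ) ^ 2)⁻¹ := by
        simpa using hN m (by omega)
      have h2 : ((m : ℝ) ^ 2)⁻¹ ≤ 2 * ((m : ℝ)⁻¹ - ((m : ℝ) + 1)⁻¹) := by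
        rw [inv_sub_inv hm0.ne' (by positivity), inv_eq_one_div, ← mul_div_assoc,
          div_le_div_iff₀ (by positivity) (by positivity)]
        nlinarith
      calc ‖x (m + 1) - x n‖ ≤ ‖x (m + 1) - x m‖ + ‖x m - x n‖ := by
            simpa using norm_add_le (x (m + 1) - x m) (x m - x n)
        _ ≤ K * (2 * ((m : ℝ)⁻¹ - ((m : ℝ) + 1)⁻¹)) + 2 * K * ((n : ℝ)⁻¹ - (m : ℝ)⁻¹) :=
            add_le_add (h1.trans (by gcongr)) ih
        _ = _ := by push_cast; ring
  have hlim : ‖l - x n‖ ≤ 2 * K * (n : ℝ)⁻¹ := by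
    refine le_of_tendsto ((hx.sub_const (x n)).norm) ?_
    filter_upwards [eventually_ge_atTop n] with m hm
    refine (step m hm).trans ?_
    gcongr
    simp
  rw [norm_sub_rev]
  simpa using hlim

/-- The trailing coefficient never vanishes, so each lower value can be solved for; the induction
corrects one value at a time. -/
theorem exists_backward_extension {p q r : ℕ → ℂ} (hr : ∀ n, r n ≠ 0) (N : ℕ) (c : ℕ → ℂ)
    (hc : ∀ n ≥ N, p n * c (n + 2) + q n * c (n + 1) + r n * c n = 0) :
    ∃ C : ℕ → ℂ, (∀ n, p n * C (n + 2) + q n * C (n + 1) + r n * C n = 0) ∧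
      ∀ n ≥ N, C n = c n := by
  induction N generalizing c with
  | zero => exact ⟨c, fun n => hc n (Nat.zero_le _), fun _ _ => rfl⟩
  | succ N ih =>
    set c' := Function.update c N (-(p N * c (N + 2) + q N * c (N + 1)) / r N) with hc'
    have h : ∀ n ≥ N, p n * c' (n + 2) + q n * c' (n + 1) + r n * c' n = 0 := by
      intro n hn
      rcases hn.eq_or_lt with rfl | hn
      · rw [hc', Function.update_of_ne (by omega), Function.update_of_ne (by omega),
          Function.update_self, mul_div_cancel₀ _ (hr N), add_neg_cancel]
      · rw [hc', Function.update_of_ne (by omega), Function.update_of_ne (by omega),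
          Function.update_of_ne (by omega)]
        exact hc n hn
    obtain ⟨C, h1, h2⟩ := ih c' h
    refine ⟨C, h1, fun n hn => ?_⟩
    rw [h2 n (by omega), hc', Function.update_of_ne (by omega)]

theorem eq_of_recurrence {p q r : ℕ → ℂ} (hp : ∀ n, p n ≠ 0) {c d : ℕ → ℂ}
    (hc : ∀ n, p n * c (n + 2) + q n * c (n + 1) + r n * c n = 0)
    (hd : ∀ n, p n * d (n + 2) + q n * d (n + 1) + r n * d n = 0)
    (h0 : c 0 = d 0) (h1 : c 1 = d 1) (n : ℕ) : c n = d n := by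
  suffices c n = d n ∧ c (n + 1) = d (n + 1) from this.1
  induction n with
  | zero => exact ⟨h0, h1⟩
  | succ n ih =>
    refine ⟨ih.2, mul_left_cancel₀ (hp n) ?_⟩
    linear_combination hc n - hd n - q n * ih.2 - r n * ih.1

/-- A nowhere vanishing `C¹` function on an open set of reals has a `C¹` argument. -/
theorem exists_contDiff_arg {U : Set ℝ} (hU : IsOpen U) {Z : ℝ → ℂ} (hZ : ContDiffOn ℝ 1 Z U)
    (hZ0 : ∀ x ∈ U, Z x ≠ 0) :
    ∃ ζ : ℝ → ℝ, ContDiffOn ℝ 1 ζ U ∧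
      ∀ x ∈ U, Z x = (‖Z x‖ : ℂ) * Complex.exp (Complex.I * (ζ x : ℂ)) := by
  classical
  -- The base point depends only on the component as a set, so all points of one component share it
  -- and the primitive of `Z'/Z` is consistent there.
  let base : Set ℝ → ℝ := fun K => if h : K.Nonempty then h.some else 0
  let b : ℝ → ℝ := fun x => base (connectedComponentIn U x)
  let g : ℝ → ℂ := fun x => deriv Z x / Z x
  let w : ℝ → ℂ := fun x => Complex.log (Z (b x)) + ∫ t in (b x)..x, g t
  have hg : ContinuousOn g U :=
    (hZ.continuousOn_deriv_of_isOpen hU le_rfl).div hZ.continuousOn hZ0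
  have key : ∀ x₀ ∈ U, ∃ K, IsOpen K ∧ x₀ ∈ K ∧ K ⊆ U ∧ ContDiffOn ℝ 1 w K ∧
      ∀ x ∈ K, Complex.exp (w x) = Z x := by
    intro x₀ hx₀
    set K := connectedComponentIn U x₀ with hK
    have hKo : IsOpen K := hU.connectedComponentIn
    have hxK : x₀ ∈ K := mem_connectedComponentIn hx₀
    have hKU : K ⊆ U := connectedComponentIn_subset U x₀
    have hKp : IsPreconnected K := isPreconnected_connectedComponentIn
    have hbK : base K ∈ K := by
      have : K.Nonempty := ⟨x₀, hxK⟩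
      simp only [base, dif_pos this]
      exact this.some_mem
    have hb : ∀ x ∈ K, b x = base K := fun x hx => by
      simp only [b, hK, connectedComponentIn_eq hx]
    have hgK : ContinuousOn g K := hg.mono hKU
    have hder : ∀ x ∈ K, HasDerivAt w (g x) x := by
      intro x hx
      have h1 : HasDerivAt (fun x => Complex.log (Z (base K)) + ∫ t in (base K)..x, g t) (g x) x := by
        refine (intervalIntegral.integral_hasDerivAt_right ?_ ?_
          (hgK.continuousAt (hKo.mem_nhds hx))).const_add _
        · exact (hgK.mono (hKp.ordConnected.uIcc_subset hbK hx)).intervalIntegrable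
        · exact hgK.stronglyMeasurableAtFilter hKo x hx
      refine h1.congr_of_eventuallyEq ?_
      filter_upwards [hKo.mem_nhds hx] with y hy
      simp only [w, hb y hy]
    have hZd : ∀ x ∈ K, HasDerivAt Z (deriv Z x) x := fun x hx =>
      ((hZ.differentiableOn one_ne_zero).differentiableAt (hU.mem_nhds (hKU hx))).hasDerivAt
    refine ⟨K, hKo, hxK, hKU, ?_, ?_⟩
    · rw [show (1 : WithTop ℕ∞) = 0 + 1 by simp, contDiffOn_succ_iff_deriv_of_isOpen hKo]
      refine ⟨fun x hx => (hder x hx).differentiableAt.differentiableWithinAt, by simp, ?_⟩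
      rw [contDiffOn_zero]
      exact hgK.congr fun x hx => (hder x hx).deriv
    -- `Z e^{-w}` is constant on the component and equals `1` at the base point.
    · have hd : ∀ x ∈ K, HasDerivAt (fun x => Z x * Complex.exp (-w x)) 0 x := by
        intro x hx
        have hgx : g x = deriv Z x / Z x := rfl
        have hz := hZ0 x (hKU hx)
        refine ((hZd x hx).mul ((hder x hx).neg.cexp)).congr_deriv ?_
        rw [hgx]
        field_simp
        ring
      intro x hx
      have hc := hKo.is_const_of_deriv_eq_zero (𝕜 := ℝ) hKp
        (fun x hx => (hd x hx).differentiableAt.differentiableWithinAt)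
        (fun x hx => (hd x hx).deriv) hx hbK
      have hw : Complex.exp (w (base K)) = Z (base K) := by
        simp only [w, hb _ hbK, intervalIntegral.integral_same, add_zero]
        exact Complex.exp_log (hZ0 _ (hKU hbK))
      simp only [Complex.exp_neg, hw, mul_inv_cancel₀ (hZ0 _ (hKU hbK))] at hc
      field_simp at hc
      exact hc.symm
  refine ⟨fun x => (w x).im, fun x hx => ?_, fun x hx => ?_⟩
  · obtain ⟨K, hKo, hxK, -, hw, -⟩ := key x hx
    exact ((Complex.imCLM.contDiff.contDiffAt.comp x
      (hw.contDiffAt (hKo.mem_nhds hxK)))).contDiffWithinAt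
  · obtain ⟨K, hKo, hxK, -, -, hw⟩ := key x hx
    rw [← hw x hxK, Complex.norm_exp, Complex.ofReal_exp, ← Complex.exp_add]
    congr 1
    conv_lhs => rw [← Complex.re_add_im (w x)]
    ring

end OscillatorRing

/-! ### The functions `v_n`, their smoothness in `E`, and the exceptional set. -/

namespace OscillatorRing
open Filter Topology Asymptotics Real

theorem add_sin_div_pos {k : ℝ} (hk : 0 < k) : 0 < π + sin (2 * k * π) / (2 * k) := by
  have h : -(2 * k * π) < sin (2 * k * π) := by
    have := sin_lt (show 0 < 2 * k * π by positivity)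
    have h2 : -sin (2 * k * π) < 2 * k * π := by
      rcases le_or_gt (2 * k * π) 1 with h | h
      · have := sin_pos_of_pos_of_lt_pi (show 0 < 2 * k * π by positivity)
          (by linarith [pi_gt_three])
        linarith [show 0 < 2 * k * π by positivity]
      · linarith [neg_one_le_sin (2 * k * π)]
    linarith
  have : -π < sin (2 * k * π) / (2 * k) := by
    rw [lt_div_iff₀ (by positivity)]; linarith
  linarith

theorem add_sinh_div_pos {k : ℝ} (hk : 0 < k) : 0 < π + sinh (2 * k * π) / (2 * k) := by
  have : 0 < sinh (2 * k * π) := sinh_pos_iff.2 (by positivity)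
  positivity

theorem v_zero_of_pos {ω E : ℝ} {n : ℤ} (h : 0 < waveNumberSq ω n E) :
    v ω n E 0 = (√(π + sin (2 * √(waveNumberSq ω n E) * π) / (2 * √(waveNumberSq ω n E))))⁻¹ *
      cos (√(waveNumberSq ω n E) * π) := by
  simp [v, h.le]

theorem v_zero_of_neg {ω E : ℝ} {n : ℤ} (h : waveNumberSq ω n E < 0) :
    v ω n E 0 = (√(π + sinh (2 * √(-waveNumberSq ω n E) * π) / (2 * √(-waveNumberSq ω n E))))⁻¹ *
      cosh (√(-waveNumberSq ω n E) * π) := by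
  simp [v, not_le.2 h]

theorem derivWithin_v_of_pos {ω E : ℝ} {n : ℤ} (h : 0 < waveNumberSq ω n E) :
    derivWithin (fun x => v ω n E x) (Set.Ioi 0) 0 =
      (√(π + sin (2 * √(waveNumberSq ω n E) * π) / (2 * √(waveNumberSq ω n E))))⁻¹ *
      (√(waveNumberSq ω n E) * sin (√(waveNumberSq ω n E) * π)) := by
  set k := √(waveNumberSq ω n E) with hk
  set ρ := (√(π + sin (2 * k * π) / (2 * k)))⁻¹ with hρ
  have h1 : HasDerivAt (fun x => ρ * cos (k * (x - π))) (ρ * (k * sin (k * π))) 0 := by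
    refine (((((hasDerivAt_id (0 : ℝ)).sub_const π).const_mul k).cos).const_mul ρ).congr_deriv ?_
    simp only [id, zero_sub, mul_neg, mul_one, sin_neg, neg_neg]
    ring
  refine HasDerivWithinAt.derivWithin ?_ (uniqueDiffWithinAt_Ioi 0)
  refine h1.hasDerivWithinAt.congr (fun x hx => ?_) ?_
  · simp [v, h.le, abs_of_pos (show 0 < x from hx), hρ, hk]
  · simp [v, h.le, hρ, hk]

theorem derivWithin_v_of_neg {ω E : ℝ} {n : ℤ} (h : waveNumberSq ω n E < 0) :
    derivWithin (fun x => v ω n E x) (Set.Ioi 0) 0 =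
      -((√(π + sinh (2 * √(-waveNumberSq ω n E) * π) / (2 * √(-waveNumberSq ω n E))))⁻¹ *
      (√(-waveNumberSq ω n E) * sinh (√(-waveNumberSq ω n E) * π))) := by
  set k := √(-waveNumberSq ω n E) with hk
  set ρ := (√(π + sinh (2 * k * π) / (2 * k)))⁻¹ with hρ
  have h1 : HasDerivAt (fun x => ρ * cosh (k * (x - π))) (-(ρ * (k * sinh (k * π)))) 0 := by
    refine (((((hasDerivAt_id (0 : ℝ)).sub_const π).const_mul k).cosh).const_mul ρ).congr_deriv ?_
    simp only [id, zero_sub, mul_neg, neg_mul, mul_one, sinh_neg]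
    ring
  refine HasDerivWithinAt.derivWithin ?_ (uniqueDiffWithinAt_Ioi 0)
  refine h1.hasDerivWithinAt.congr (fun x hx => ?_) ?_
  · simp [v, not_le.2 h, abs_of_pos (show 0 < x from hx), hρ, hk]
  · simp [v, not_le.2 h, hρ, hk]

theorem contDiff_waveNumberSq (ω : ℝ) (n : ℤ) : ContDiff ℝ 1 (waveNumberSq ω n) := by
  unfold waveNumberSq; fun_prop

theorem contDiffAt_v_zero {ω E : ℝ} {n : ℤ} (h : waveNumberSq ω n E ≠ 0) :
    ContDiffAt ℝ 1 (fun E => v ω n E 0) E := by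
  have hw := (contDiff_waveNumberSq ω n).contDiffAt (x := E)
  rcases h.lt_or_gt with h | h
  · have hk : ContDiffAt ℝ 1 (fun E => √(-waveNumberSq ω n E)) E := hw.neg.sqrt (by simpa using h.ne)
    have hk0 : 0 < √(-waveNumberSq ω n E) := sqrt_pos.2 (by linarith)
    have h1 : ContDiffAt ℝ 1 (fun E => (√(π + sinh (2 * √(-waveNumberSq ω n E) * π) /
        (2 * √(-waveNumberSq ω n E))))⁻¹ * cosh (√(-waveNumberSq ω n E) * π)) E := by
      refine ContDiffAt.mul (ContDiffAt.inv (ContDiffAt.sqrt (contDiffAt_const.add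
        (ContDiffAt.div (((contDiffAt_const.mul hk).mul contDiffAt_const).sinh)
        (contDiffAt_const.mul hk) (by positivity))) ?_) ?_) ((hk.mul contDiffAt_const).cosh)
      · exact (add_sinh_div_pos hk0).ne'
      · exact (sqrt_pos.2 (add_sinh_div_pos hk0)).ne'
    refine h1.congr_of_eventuallyEq ?_
    filter_upwards [hw.continuousAt.eventually_lt continuousAt_const h] with y hy
    exact v_zero_of_neg hy
  · have hk : ContDiffAt ℝ 1 (fun E => √(waveNumberSq ω n E)) E := hw.sqrt h.ne'
    have hk0 : 0 < √(waveNumberSq ω n E) := sqrt_pos.2 (by linarith)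
    have h1 : ContDiffAt ℝ 1 (fun E => (√(π + sin (2 * √(waveNumberSq ω n E) * π) /
        (2 * √(waveNumberSq ω n E))))⁻¹ * cos (√(waveNumberSq ω n E) * π)) E := by
      refine ContDiffAt.mul (ContDiffAt.inv (ContDiffAt.sqrt (contDiffAt_const.add
        (ContDiffAt.div (((contDiffAt_const.mul hk).mul contDiffAt_const).sin)
        (contDiffAt_const.mul hk) (by positivity))) ?_) ?_) ((hk.mul contDiffAt_const).cos)
      · exact (add_sin_div_pos hk0).ne'
      · exact (sqrt_pos.2 (add_sin_div_pos hk0)).ne'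
    refine h1.congr_of_eventuallyEq ?_
    filter_upwards [continuousAt_const.eventually_lt hw.continuousAt h] with y hy
    exact v_zero_of_pos hy

theorem contDiffAt_derivWithin_v {ω E : ℝ} {n : ℤ} (h : waveNumberSq ω n E ≠ 0) :
    ContDiffAt ℝ 1 (fun E => derivWithin (fun x => v ω n E x) (Set.Ioi 0) 0) E := by
  have hw := (contDiff_waveNumberSq ω n).contDiffAt (x := E)
  rcases h.lt_or_gt with h | h
  · have hk : ContDiffAt ℝ 1 (fun E => √(-waveNumberSq ω n E)) E := hw.neg.sqrt (by simpa using h.ne)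
    have hk0 : 0 < √(-waveNumberSq ω n E) := sqrt_pos.2 (by linarith)
    have h1 : ContDiffAt ℝ 1 (fun E => -((√(π + sinh (2 * √(-waveNumberSq ω n E) * π) /
        (2 * √(-waveNumberSq ω n E))))⁻¹ *
        (√(-waveNumberSq ω n E) * sinh (√(-waveNumberSq ω n E) * π)))) E := by
      refine (ContDiffAt.mul (ContDiffAt.inv (ContDiffAt.sqrt (contDiffAt_const.add
        (ContDiffAt.div (((contDiffAt_const.mul hk).mul contDiffAt_const).sinh)
        (contDiffAt_const.mul hk) (by positivity))) ?_) ?_)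
        (hk.mul (hk.mul contDiffAt_const).sinh)).neg
      · exact (add_sinh_div_pos hk0).ne'
      · exact (sqrt_pos.2 (add_sinh_div_pos hk0)).ne'
    refine h1.congr_of_eventuallyEq ?_
    filter_upwards [hw.continuousAt.eventually_lt continuousAt_const h] with y hy
    exact derivWithin_v_of_neg hy
  · have hk : ContDiffAt ℝ 1 (fun E => √(waveNumberSq ω n E)) E := hw.sqrt h.ne'
    have hk0 : 0 < √(waveNumberSq ω n E) := sqrt_pos.2 (by linarith)
    have h1 : ContDiffAt ℝ 1 (fun E => (√(π + sin (2 * √(waveNumberSq ω n E) * π) /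
        (2 * √(waveNumberSq ω n E))))⁻¹ *
        (√(waveNumberSq ω n E) * sin (√(waveNumberSq ω n E) * π))) E := by
      refine ContDiffAt.mul (ContDiffAt.inv (ContDiffAt.sqrt (contDiffAt_const.add
        (ContDiffAt.div (((contDiffAt_const.mul hk).mul contDiffAt_const).sin)
        (contDiffAt_const.mul hk) (by positivity))) ?_) ?_)
        (hk.mul (hk.mul contDiffAt_const).sin)
      · exact (add_sin_div_pos hk0).ne'
      · exact (sqrt_pos.2 (add_sin_div_pos hk0)).ne'
    refine h1.congr_of_eventuallyEq ?_
    filter_upwards [continuousAt_const.eventually_lt hw.continuousAt h] with y hy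
    exact derivWithin_v_of_pos hy

theorem v_zero_pos_of_neg {ω E : ℝ} {n : ℤ} (h : waveNumberSq ω n E < 0) : 0 < v ω n E 0 := by
  rw [v_zero_of_neg h]
  exact mul_pos (inv_pos.2 (sqrt_pos.2 (add_sinh_div_pos (sqrt_pos.2 (by linarith))))) (cosh_pos _)

/-- The zeros of `h₂(n)` are those of `v_{n+2}(0)`, already counted by `h₀(n+2)`; only the zeros of
the `v_n(0)` and the thresholds remain. -/
theorem notMem_exceptionalEnergies_iff {α ω E : ℝ} (hω : 0 < ω) (hα : ω < α) :
    E ∉ exceptionalEnergies α ω ↔ ∀ n : ℕ, v ω n E 0 ≠ 0 ∧ waveNumberSq ω n E ≠ 0 := by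
  have hα0 : α ≠ 0 := (hω.trans hα).ne'
  have e0 : ∀ n : ℕ, h₀ α ω n E = 0 ↔ v ω n E 0 = 0 := by
    intro n
    have : √((n : ℝ) + 1) ≠ 0 := by positivity
    simp [h₀, hα0, this]
  have e2 : ∀ n : ℕ, h₂ α ω n E = 0 ↔ v ω ((n + 2 : ℕ) : ℤ) E 0 = 0 := by
    intro n
    have : √((n : ℝ) + 2) ≠ 0 := by positivity
    simp [h₂, hα0, this]
  have e3 : ∀ n : ℕ, E = ((n : ℝ) + 1 / 2) * ω ↔ waveNumberSq ω n E = 0 := by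
    intro n
    simp only [waveNumberSq, Int.cast_natCast]
    constructor <;> intro h <;> linarith
  simp only [exceptionalEnergies, singularEnergies, Set.mem_union, Set.mem_ofPred_eq, e0, e2, e3]
  constructor
  · intro h n
    push Not at h
    exact ⟨(h.1 n).2, h.2 n⟩
  · rintro h (⟨n, h1 | h1⟩ | ⟨n, h1⟩)
    · exact (h _).1 h1
    · exact (h _).1 h1
    · exact (h _).2 h1

theorem exists_forall_waveNumberSq_neg {ω : ℝ} (hω : 0 < ω) (B : ℝ) :
    ∃ N : ℕ, ∀ n ≥ N, ∀ E < B, waveNumberSq ω n E < 0 := by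
  obtain ⟨N, hN⟩ := exists_nat_gt (B / ω)
  refine ⟨N, fun n hn E hE => ?_⟩
  rw [div_lt_iff₀ hω] at hN
  have : (N : ℝ) * ω ≤ n * ω := by gcongr
  simp only [waveNumberSq, Int.cast_natCast]
  linarith

/-- Locally in `E` only finitely many indices matter: for the others `k_n² < 0`, which forces
`v_n(0) > 0`. -/
theorem isOpen_compl_exceptionalEnergies {α ω : ℝ} (hω : 0 < ω) (hα : ω < α) :
    IsOpen (exceptionalEnergies α ω)ᶜ := by
  rw [isOpen_iff_mem_nhds]
  intro E hE
  rw [Set.mem_compl_iff, notMem_exceptionalEnergies_iff hω hα] at hE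
  obtain ⟨N, hN⟩ := exists_forall_waveNumberSq_neg hω (E + 1)
  have h1 : ∀ᶠ y in 𝓝 E, ∀ n ∈ Finset.range N, v ω n y 0 ≠ 0 ∧ waveNumberSq ω n y ≠ 0 := by
    rw [Filter.eventually_all_finset]
    intro n _
    exact ((contDiffAt_v_zero (hE n).2).continuousAt.eventually_ne (hE n).1).and
      ((contDiff_waveNumberSq ω n).continuous.continuousAt.eventually_ne (hE n).2)
  filter_upwards [h1, eventually_lt_nhds (show E < E + 1 by linarith)] with y hy hy1
  rw [Set.mem_compl_iff, notMem_exceptionalEnergies_iff hω hα]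
  intro n
  by_cases hn : n < N
  · exact hy n (Finset.mem_range.2 hn)
  · have := hN n (not_lt.1 hn) y hy1
    exact ⟨(v_zero_pos_of_neg this).ne', this.ne⟩

section Coefficients
variable {α ω E : ℝ}

theorem h₂_ne_zero (hE : E ∉ exceptionalEnergies α ω) (n : ℕ) :
    h₂ α ω n E ≠ 0 := fun h => hE (Or.inl ⟨n, Or.inl h⟩)

theorem h₀_ne_zero (hE : E ∉ exceptionalEnergies α ω) (n : ℕ) :
    h₀ α ω n E ≠ 0 := fun h => hE (Or.inl ⟨n, Or.inr h⟩)

theorem h₂_neg_one_ne_zero (hω : 0 < ω) (hα : ω < α) (hE : E ∉ exceptionalEnergies α ω) :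
    h₂ α ω (-1) E ≠ 0 := by
  have := ((notMem_exceptionalEnergies_iff hω hα).1 hE 1).1
  have e : (-1 : ℤ) + 2 = ((1 : ℕ) : ℤ) := by norm_num
  rw [h₂, e]
  have h2 : α ≠ 0 := (hω.trans hα).ne'
  have h3 : √(((-1 : ℤ) : ℝ) + 2) ≠ 0 := by norm_num
  positivity

theorem contDiffAt_h₂ (hω : 0 < ω) (hα : ω < α) (hE : E ∉ exceptionalEnergies α ω) {n : ℤ}
    (hn : -1 ≤ n) : ContDiffAt ℝ 1 (h₂ α ω n) E := by
  obtain ⟨m, hm⟩ := Int.eq_ofNat_of_zero_le (show 0 ≤ n + 2 by omega)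
  have := contDiffAt_v_zero ((notMem_exceptionalEnergies_iff hω hα).1 hE m).2
  unfold h₂
  rw [hm]
  exact contDiffAt_const.mul this

theorem contDiffAt_h₁ (hω : 0 < ω) (hα : ω < α) (hE : E ∉ exceptionalEnergies α ω) {n : ℤ}
    (hn : -1 ≤ n) : ContDiffAt ℝ 1 (h₁ ω n) E := by
  obtain ⟨m, hm⟩ := Int.eq_ofNat_of_zero_le (show 0 ≤ n + 1 by omega)
  have := contDiffAt_derivWithin_v ((notMem_exceptionalEnergies_iff hω hα).1 hE m).2
  unfold h₁
  rw [hm]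
  exact contDiffAt_const.mul this

theorem contDiffAt_h₀ (hω : 0 < ω) (hα : ω < α) (hE : E ∉ exceptionalEnergies α ω) (n : ℕ) :
    ContDiffAt ℝ 1 (h₀ α ω n) E :=
  contDiffAt_const.mul (contDiffAt_v_zero ((notMem_exceptionalEnergies_iff hω hα).1 hE n).2)

end Coefficients

end OscillatorRing

/-! ### Trial solutions of the reduced recurrence and the size of their residual. -/

namespace OscillatorRing
open Filter Topology Asymptotics

noncomputable section

/-- The exponent of the power of `m` in the approximate solution `trialSol`. -/
def trialExp (μ τ : ℝ) (E : ℂ) : ℂ := -(1 / 4) + Complex.I * τ * μ * E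

/-- The approximate solution `m ^ (-1/4 + iτμE) e^{iτmθ}` of the reduced recurrence. -/
def trialSol (ϑ μ τ : ℝ) (m : ℕ) (E : ℂ) : ℂ :=
  Complex.exp (trialExp μ τ E * Real.log m + Complex.I * τ * m * ϑ)

/-- `√(1 + (1/2 - E/ω)/m)`, continued to complex `E`. -/
def relWave (ω : ℝ) (m : ℕ) (E : ℂ) : ℂ :=
  Complex.exp (1 / 2 * Complex.log (1 + (1 / 2 - E / ω) / m))

/-- `exp (-2πχ_m)`, continued to complex `E`. -/
def expWave (ω : ℝ) (m : ℕ) (E : ℂ) : ℂ :=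
  Complex.exp (-(2 * Real.pi * √(2 * ω * m) : ℝ) * relWave ω m E)

/-- The middle coefficient of the reduced recurrence, divided by `√m`. -/
def midCoeff (ϑ ω : ℝ) (m : ℕ) (E : ℂ) : ℂ :=
  2 * Real.cos ϑ * (relWave ω m E * ((1 - expWave ω m E) / (1 + expWave ω m E)))

/-- `log (m + 1) - log m`. -/
def logStep (m : ℕ) : ℝ := Real.log (m + 1) - Real.log m

/-- The relative residual of `trialSol` in the reduced recurrence. -/
def residual (ϑ ω μ τ : ℝ) (m : ℕ) (E : ℂ) : ℂ :=
  Complex.exp ((trialExp μ τ E + 1 / 2) * logStep m + Complex.I * τ * ϑ) +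
    Complex.exp (-trialExp μ τ E * logStep (m - 1) - Complex.I * τ * ϑ) - midCoeff ϑ ω m E

/-- Large `m`, and energies close to `E₀`. -/
abbrev nearInfty (E₀ : ℂ) : Filter (ℕ × ℂ) := atTop ×ˢ 𝓝 E₀

section Estimates

variable (E₀ : ℂ)

theorem tendsto_inv_fst : Tendsto (fun x : ℕ × ℂ => ((x.1 : ℂ))⁻¹) (nearInfty E₀) (𝓝 0) :=
  (tendsto_inv_atTop_nhds_zero_nat (𝕜 := ℂ)).comp tendsto_fst

theorem isBigO_one_of_continuous {f : ℂ → ℂ} (hf : Continuous f) :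
    (fun x : ℕ × ℂ => f x.2) =O[nearInfty E₀] fun _ => (1 : ℂ) :=
  ((hf.tendsto E₀).comp tendsto_snd).isBigO_one ℂ

theorem inv_sq_isBigO_inv :
    (fun x : ℕ × ℂ => ((x.1 : ℂ))⁻¹ ^ 2) =O[nearInfty E₀] fun x => ((x.1 : ℂ))⁻¹ := by
  have := (isBigO_refl (fun x : ℕ × ℂ => ((x.1 : ℂ))⁻¹) (nearInfty E₀)).mul
    ((tendsto_inv_fst E₀).isBigO_one ℂ)
  simpa [sq] using this

variable {E₀}

theorem exp_sub_isBigO {x y : ℕ × ℂ → ℂ} (hy : y =O[nearInfty E₀] fun x => ((x.1 : ℂ))⁻¹)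
    (hxy : (fun p => x p - y p) =O[nearInfty E₀] fun x => ((x.1 : ℂ))⁻¹ ^ 2) :
    (fun p => Complex.exp (x p) - (1 + y p)) =O[nearInfty E₀] fun x => ((x.1 : ℂ))⁻¹ ^ 2 := by
  have hx : x =O[nearInfty E₀] fun x => ((x.1 : ℂ))⁻¹ := by
    simpa using (hxy.trans (inv_sq_isBigO_inv E₀)).add hy
  have hx0 : Tendsto x (nearInfty E₀) (𝓝 0) := hx.trans_tendsto (tendsto_inv_fst E₀)
  have h1 : (fun z : ℂ => Complex.exp z - 1 - z) =O[𝓝 0] fun z => z ^ 2 := by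
    refine IsBigO.of_bound 1 ?_
    filter_upwards [Metric.closedBall_mem_nhds (0 : ℂ) one_pos] with z hz
    simpa using Complex.norm_exp_sub_one_sub_id_le (by simpa using hz)
  have h2 := (h1.comp_tendsto hx0).trans (hx.pow 2)
  refine (h2.add hxy).congr_left fun p => ?_
  simp only [Function.comp]
  ring

theorem logStep_isBigO :
    (fun x : ℕ × ℂ => (logStep x.1 : ℂ) - ((x.1 : ℂ))⁻¹) =O[nearInfty E₀] fun x => ((x.1 : ℂ))⁻¹ ^ 2 := by
  refine IsBigO.of_bound 1 ?_
  filter_upwards [tendsto_fst.eventually (eventually_ge_atTop 1)] with p hp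
  have hp0 : (0 : ℝ) < p.1 := by exact_mod_cast hp
  have e : logStep p.1 = Real.log (((p.1 : ℝ) + 1) / p.1) := by
    rw [logStep, Real.log_div (by positivity) hp0.ne']
  have h1 := Real.log_le_sub_one_of_pos (show 0 < ((p.1 : ℝ) + 1) / p.1 by positivity)
  have h2 := Real.one_sub_inv_le_log_of_pos (show 0 < ((p.1 : ℝ) + 1) / p.1 by positivity)
  rw [← e] at h1 h2
  have e1 : ((p.1 : ℝ) + 1) / p.1 - 1 = (p.1 : ℝ)⁻¹ := by field_simp; ring
  have e2 : (p.1 : ℝ)⁻¹ - ((p.1 : ℝ)⁻¹) ^ 2 ≤ 1 - (((p.1 : ℝ) + 1) / p.1)⁻¹ := by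
    have : 1 - (((p.1 : ℝ) + 1) / p.1)⁻¹ - ((p.1 : ℝ)⁻¹ - ((p.1 : ℝ)⁻¹) ^ 2) =
      ((p.1 : ℝ) + 1)⁻¹ * (p.1 : ℝ)⁻¹ ^ 2 := by field_simp; ring
    have h : 0 ≤ ((p.1 : ℝ) + 1)⁻¹ * (p.1 : ℝ)⁻¹ ^ 2 := by positivity
    linarith
  have : ‖(logStep p.1 : ℂ) - ((p.1 : ℂ))⁻¹‖ = |logStep p.1 - (p.1 : ℝ)⁻¹| := by
    rw [← Real.norm_eq_abs, ← Complex.norm_real]; push_cast; rfl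
  rw [this, abs_le]
  simp only [norm_pow, norm_inv, Complex.norm_natCast, one_mul]
  constructor <;> linarith [sq_nonneg ((p.1 : ℝ)⁻¹)]

theorem logStep_pred_isBigO :
    (fun x : ℕ × ℂ => (logStep (x.1 - 1) : ℂ) - ((x.1 : ℂ))⁻¹) =O[nearInfty E₀]
      fun x => ((x.1 : ℂ))⁻¹ ^ 2 := by
  refine IsBigO.of_bound 2 ?_
  filter_upwards [tendsto_fst.eventually (eventually_ge_atTop 2)] with p hp
  obtain ⟨k, hk⟩ := Nat.exists_eq_add_of_le' (show 1 ≤ p.1 by omega)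
  rw [hk]
  have hk1 : (1 : ℝ) ≤ k := by exact_mod_cast (show 1 ≤ k by omega)
  have hp0 : (0 : ℝ) < k := by linarith
  have e : logStep k = Real.log (((k : ℝ) + 1) / k) := by
    rw [logStep, Real.log_div (by positivity) hp0.ne']
  have h1 := Real.log_le_sub_one_of_pos (show 0 < ((k : ℝ) + 1) / k by positivity)
  have h2 := Real.one_sub_inv_le_log_of_pos (show 0 < ((k : ℝ) + 1) / k by positivity)
  rw [← e] at h1 h2
  have e1 : ((k : ℝ) + 1) / k - 1 ≤ ((k : ℝ) + 1)⁻¹ + 2 * ((k : ℝ) + 1)⁻¹ ^ 2 := by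
    have : ((k : ℝ) + 1)⁻¹ + 2 * ((k : ℝ) + 1)⁻¹ ^ 2 - (((k : ℝ) + 1) / k - 1) =
      (k - 1) * ((k : ℝ)⁻¹ * ((k : ℝ) + 1)⁻¹ ^ 2) := by field_simp; ring
    have h : 0 ≤ (k - 1) * ((k : ℝ)⁻¹ * ((k : ℝ) + 1)⁻¹ ^ 2) :=
      mul_nonneg (by linarith) (by positivity)
    linarith
  have e2 : 1 - (((k : ℝ) + 1) / k)⁻¹ = ((k : ℝ) + 1)⁻¹ := by field_simp; ring
  have : ‖(logStep k : ℂ) - (((k + 1 : ℕ) : ℂ))⁻¹‖ = |logStep k - ((k : ℝ) + 1)⁻¹| := by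
    rw [← Real.norm_eq_abs, ← Complex.norm_real]; push_cast; rfl
  rw [Nat.add_sub_cancel, this, abs_le]
  simp only [norm_pow, norm_inv, Complex.norm_natCast]
  push_cast
  constructor <;> linarith [sq_nonneg (((k : ℝ) + 1)⁻¹)]

theorem exp_mul_logStep_isBigO {q : ℂ → ℂ} (hq : Continuous q) {ℓ : ℕ → ℝ}
    (hℓ : (fun x : ℕ × ℂ => (ℓ x.1 : ℂ) - ((x.1 : ℂ))⁻¹) =O[nearInfty E₀] fun x => ((x.1 : ℂ))⁻¹ ^ 2) :
    (fun x : ℕ × ℂ => Complex.exp (q x.2 * ℓ x.1) - (1 + q x.2 * ((x.1 : ℂ))⁻¹)) =O[nearInfty E₀]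
      fun x => ((x.1 : ℂ))⁻¹ ^ 2 := by
  have h := isBigO_one_of_continuous E₀ hq
  refine exp_sub_isBigO (by simpa using h.mul (isBigO_refl _ _)) ?_
  simpa [mul_sub] using h.mul hℓ

theorem relWave_isBigO (ω : ℝ) :
    (fun x : ℕ × ℂ => relWave ω x.1 x.2 - (1 + 1 / 2 * (1 / 2 - x.2 / ω) * ((x.1 : ℂ))⁻¹)) =O[nearInfty E₀]
      fun x => ((x.1 : ℂ))⁻¹ ^ 2 := by
  have hc : Continuous fun E : ℂ => 1 / 2 - E / (ω : ℂ) := by fun_prop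
  have h0 := isBigO_one_of_continuous E₀ hc
  have h1 : (fun x : ℕ × ℂ => (1 / 2 - x.2 / ω) / (x.1 : ℂ)) =O[nearInfty E₀] fun x => ((x.1 : ℂ))⁻¹ := by
    simpa [div_eq_mul_inv] using h0.mul (isBigO_refl (fun x : ℕ × ℂ => ((x.1 : ℂ))⁻¹) (nearInfty E₀))
  have h2 := h1.trans_tendsto (tendsto_inv_fst E₀)
  have h3 := (Complex.log_sub_self_isBigO.comp_tendsto h2).trans (h1.pow 2)
  unfold relWave
  refine exp_sub_isBigO ((h1.const_mul_left (1 / 2)).congr_left fun p => ?_)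
    ((h3.const_mul_left (1 / 2)).congr_left fun p => ?_)
  · ring
  · simp only [Function.comp]
    ring

theorem tendsto_relWave (ω : ℝ) : Tendsto (fun x : ℕ × ℂ => relWave ω x.1 x.2) (nearInfty E₀) (𝓝 1) := by
  have hc : Continuous fun E : ℂ => 1 / 2 * (1 / 2 - E / (ω : ℂ)) := by fun_prop
  have h0 := (((hc.tendsto E₀).comp (tendsto_snd (f := (atTop : Filter ℕ)))).mul
    (tendsto_inv_fst E₀)).const_add 1
  have h1 := (relWave_isBigO (E₀ := E₀) ω).trans_tendsto (by simpa using (tendsto_inv_fst E₀).pow 2)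
  simpa using h1.add h0

theorem expWave_isBigO {ω : ℝ} (hω : 0 < ω) :
    (fun x : ℕ × ℂ => expWave ω x.1 x.2) =O[nearInfty E₀] fun x => ((x.1 : ℂ))⁻¹ ^ 2 := by
  -- The power `-4` is taken in the variable `√m`, so it yields `m⁻²`.
  have h1 := (isLittleO_exp_neg_mul_rpow_atTop
    (show 0 < Real.pi * √(2 * ω) by positivity) (-4)).isBigO
  have h2 : Tendsto (fun x : ℕ × ℂ => √(x.1 : ℝ)) (nearInfty E₀) atTop :=
    (Real.tendsto_sqrt_atTop.comp tendsto_natCast_atTop_atTop).comp tendsto_fst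
  have h3 := h1.comp_tendsto h2
  -- Half of the limit value `1` still leaves the decay rate `π√(2ω)` in `√m`, uniformly for `E`
  -- near `E₀`.
  have hre : ∀ᶠ x : ℕ × ℂ in (nearInfty E₀), 1 / 2 < (relWave ω x.1 x.2).re :=
    ((Complex.continuous_re.tendsto _).comp (tendsto_relWave ω)).eventually
      (lt_mem_nhds (by norm_num))
  refine (IsBigO.trans (IsBigO.of_bound 1 ?_) h3).trans (IsBigO.of_bound 1 ?_)
  · filter_upwards [hre] with p hp
    have hs : √(2 * ω * (p.1 : ℝ)) = √(2 * ω) * √(p.1 : ℝ) := Real.sqrt_mul (by positivity) _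
    have hre : (-(2 * Real.pi * √(2 * ω * p.1) : ℝ) * relWave ω p.1 p.2).re =
        -(2 * Real.pi * √(2 * ω * p.1)) * (relWave ω p.1 p.2).re := by
      rw [← Complex.ofReal_neg, Complex.re_ofReal_mul]
    rw [expWave, Complex.norm_exp, hre, hs]
    simp only [Function.comp, Real.norm_eq_abs, Real.abs_exp, one_mul]
    apply Real.exp_le_exp.2
    have h0 : 0 ≤ Real.pi * √(2 * ω) * √(p.1 : ℝ) := by positivity
    nlinarith
  · filter_upwards [tendsto_fst.eventually (eventually_ge_atTop 1)] with p hp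
    have hp0 : (0 : ℝ) < p.1 := by exact_mod_cast hp
    simp only [Function.comp, norm_pow, norm_inv, Complex.norm_natCast, one_mul]
    rw [Real.norm_of_nonneg (by positivity), Real.rpow_neg (by positivity)]
    have : (√(p.1 : ℝ)) ^ (4 : ℝ) = (p.1 : ℝ) ^ 2 := by
      rw [show (4 : ℝ) = ((4 : ℕ) : ℝ) by norm_num, Real.rpow_natCast,
        show 4 = 2 * 2 by norm_num, pow_mul, Real.sq_sqrt hp0.le]
    rw [this, inv_pow]

/-- The quotient `(1 - t)/(1 + t)` is `tanh` and differs from `1` by a bounded multiple of `t =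
expWave`, so only the expansion of the square root contributes at order `1/m`. -/
theorem midCoeff_isBigO (ϑ : ℝ) {ω : ℝ} (hω : 0 < ω) :
    (fun x : ℕ × ℂ => midCoeff ϑ ω x.1 x.2 -
      2 * Real.cos ϑ * (1 + 1 / 2 * (1 / 2 - x.2 / ω) * ((x.1 : ℂ))⁻¹)) =O[nearInfty E₀]
      fun x => ((x.1 : ℂ))⁻¹ ^ 2 := by
  have ht := expWave_isBigO (E₀ := E₀) hω
  have ht0 : Tendsto (fun x : ℕ × ℂ => expWave ω x.1 x.2) (nearInfty E₀) (𝓝 0) :=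
    ht.trans_tendsto (by simpa using (tendsto_inv_fst E₀).pow 2)
  have hf := tendsto_relWave (E₀ := E₀) ω
  have hb : Tendsto (fun x : ℕ × ℂ => relWave ω x.1 x.2 * (-2 / (1 + expWave ω x.1 x.2))) (nearInfty E₀)
      (𝓝 (1 * (-2 / (1 + 0)))) :=
    hf.mul (tendsto_const_nhds.div (ht0.const_add 1) (by norm_num))
  have h1 := (hb.isBigO_one ℂ).mul ht
  have h2 := ((relWave_isBigO (E₀ := E₀) ω).add (by simpa using h1)).const_mul_left
    (2 * Real.cos ϑ : ℂ)
  refine h2.congr' ?_ EventuallyEq.rfl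
  have hne : ∀ᶠ x : ℕ × ℂ in (nearInfty E₀), 1 + expWave ω x.1 x.2 ≠ 0 :=
    (ht0.const_add 1).eventually_ne (by norm_num)
  filter_upwards [hne] with p hp
  rw [midCoeff]
  have : (1 - expWave ω p.1 p.2) / (1 + expWave ω p.1 p.2) =
      1 + -2 / (1 + expWave ω p.1 p.2) * expWave ω p.1 p.2 := by
    field_simp; ring
  rw [this]
  ring

theorem continuous_trialExp (μ τ : ℝ) : Continuous (trialExp μ τ) := by
  unfold trialExp; fun_prop

/-- The constant terms cancel since `e^{iτϑ} + e^{-iτϑ} = 2 cos ϑ`. At order `1/m` the real part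
`-1/4` of the exponent at real energies balances the energy-free term `(cos ϑ)/2`, and the condition
on `μ` balances the term linear in `E`. -/
theorem residual_isBigO {ϑ ω μ τ : ℝ} (hω : 0 < ω) (hτ : τ = 1 ∨ τ = -1)
    (hμ : 2 * ω * μ * Real.sin ϑ = Real.cos ϑ) :
    (fun x : ℕ × ℂ => residual ϑ ω μ τ x.1 x.2) =O[nearInfty E₀] fun x => ((x.1 : ℂ))⁻¹ ^ 2 := by
  have hp := continuous_trialExp μ τ
  have h1 := (exp_mul_logStep_isBigO (E₀ := E₀) (q := fun E => trialExp μ τ E + 1 / 2)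
    (by fun_prop) logStep_isBigO).const_mul_left (Complex.exp (Complex.I * τ * ϑ))
  have h2 := (exp_mul_logStep_isBigO (E₀ := E₀) (q := fun E => -trialExp μ τ E)
    (ℓ := fun m => logStep (m - 1)) (by fun_prop) logStep_pred_isBigO).const_mul_left (Complex.exp (-(Complex.I * τ * ϑ)))
  refine ((h1.add h2).sub (midCoeff_isBigO ϑ hω)).congr_left fun p => ?_
  have hω' : (ω : ℂ) ≠ 0 := by exact_mod_cast hω.ne'
  have hμ' : 2 * (ω : ℂ) * μ * Complex.sin ϑ = Complex.cos ϑ := by exact_mod_cast hμ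
  have e1 : Complex.exp (Complex.I * τ * ϑ) = Complex.cos ϑ + τ * Complex.sin ϑ * Complex.I := by
    rw [show Complex.I * τ * ϑ = ((τ * ϑ : ℝ) : ℂ) * Complex.I by push_cast; ring,
      Complex.exp_mul_I]
    rcases hτ with rfl | rfl <;> simp
  have e2 : Complex.exp (-(Complex.I * τ * ϑ)) =
      Complex.cos ϑ - τ * Complex.sin ϑ * Complex.I := by
    rw [show -(Complex.I * τ * ϑ) = ((-(τ * ϑ) : ℝ) : ℂ) * Complex.I by push_cast; ring,
      Complex.exp_mul_I]
    rcases hτ with rfl | rfl <;> simp [sub_eq_add_neg]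
  have hτ2 : (τ : ℂ) ^ 2 = 1 := by rcases hτ with rfl | rfl <;> simp
  rw [residual, Complex.exp_add, sub_eq_add_neg (-trialExp μ τ p.2 * _), Complex.exp_add, e1, e2,
    trialExp]
  have hE : (ω : ℂ)⁻¹ * Complex.cos ϑ = 2 * μ * Complex.sin ϑ := by
    rw [← hμ']; field_simp
  push_cast
  linear_combination (-p.2 * (p.1 : ℂ)⁻¹) * hE +
    (-2 * (p.1 : ℂ)⁻¹ * μ * p.2 * Complex.sin ϑ) * ((τ : ℂ) ^ 2 * Complex.I_sq - hτ2)

end Estimates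
end
end OscillatorRing

/-! ### Variation of constants and bounds for the perturbation matrix. -/

namespace OscillatorRing
open Filter Topology Asymptotics

noncomputable section

theorem trialSol_ne_zero (ϑ μ τ : ℝ) (m : ℕ) (E : ℂ) : trialSol ϑ μ τ m E ≠ 0 :=
  Complex.exp_ne_zero _

theorem trialSol_succ (ϑ μ τ : ℝ) (m : ℕ) (E : ℂ) :
    trialSol ϑ μ τ (m + 1) E =
      trialSol ϑ μ τ m E * Complex.exp (trialExp μ τ E * logStep m + Complex.I * τ * ϑ) := by
  rw [trialSol, trialSol, ← Complex.exp_add, logStep]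
  congr 1
  push_cast
  ring

/-- All ratios of neighbouring terms are exponentials of `logStep`. The identity is formal in the
logarithms and therefore survives at `m = 0`, where `Real.log 0 = 0`. -/
theorem trialSol_residual (ϑ ω μ τ : ℝ) (m : ℕ) (E : ℂ) :
    (√((m : ℝ) + 2) : ℂ) * trialSol ϑ μ τ (m + 2) E + (√((m : ℝ) + 1) : ℂ) * trialSol ϑ μ τ m E -
      (√((m : ℝ) + 1) : ℂ) * midCoeff ϑ ω (m + 1) E * trialSol ϑ μ τ (m + 1) E =
    (√((m : ℝ) + 1) : ℂ) * trialSol ϑ μ τ (m + 1) E * residual ϑ ω μ τ (m + 1) E := by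
  have h1 : (√((m : ℝ) + 2) : ℂ) = √((m : ℝ) + 1) * Complex.exp (1 / 2 * logStep (m + 1)) := by
    have : √((m : ℝ) + 2) = √((m : ℝ) + 1) * Real.exp (1 / 2 * logStep (m + 1)) := by
      rw [logStep, Real.sqrt_eq_rpow, Real.sqrt_eq_rpow, Real.rpow_def_of_pos (by positivity),
        Real.rpow_def_of_pos (by positivity), ← Real.exp_add]
      congr 1
      push_cast
      ring_nf
    rw [this]
    push_cast
    rfl
  have h2 : trialSol ϑ μ τ m E = trialSol ϑ μ τ (m + 1) E *
      Complex.exp (-trialExp μ τ E * logStep m - Complex.I * τ * ϑ) := by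
    rw [trialSol_succ, mul_assoc, ← Complex.exp_add]
    simp
  rw [h1, h2, trialSol_succ ϑ μ τ (m + 1), residual, Nat.add_sub_cancel,
    show (trialExp μ τ E + 1 / 2) * (logStep (m + 1) : ℂ) + Complex.I * τ * ϑ =
      1 / 2 * logStep (m + 1) + (trialExp μ τ E * logStep (m + 1) + Complex.I * τ * ϑ) by ring,
    Complex.exp_add (1 / 2 * _)]
  ring

/-- The Casoratian of the two approximate solutions, divided by their product. -/
def relCasoratian (ϑ μ : ℝ) (m : ℕ) (E : ℂ) : ℂ :=
  Complex.exp (trialExp μ (-1) E * logStep m + Complex.I * (-1 : ℝ) * ϑ) -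
    Complex.exp (trialExp μ 1 E * logStep m + Complex.I * (1 : ℝ) * ϑ)

/-- The ratio of the two approximate solutions. -/
def trialRatio (ϑ μ : ℝ) (m : ℕ) (E : ℂ) : ℂ := trialSol ϑ μ 1 m E / trialSol ϑ μ (-1) m E

/-- The factor in front of the perturbation matrix. -/
def stepFactor (ϑ μ : ℝ) (m : ℕ) (E : ℂ) : ℂ :=
  (√(m : ℝ) / √((m : ℝ) + 1) : ℝ) / relCasoratian ϑ μ m E

/-- The perturbation matrix that variation of constants gives. -/
def stepMat (ϑ ω μ : ℝ) (m : ℕ) (E : ℂ) : Matrix (Fin 2) (Fin 2) ℂ :=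
  stepFactor ϑ μ m E • !![residual ϑ ω μ 1 m E, residual ϑ ω μ (-1) m E * (trialRatio ϑ μ m E)⁻¹;
    -(residual ϑ ω μ 1 m E * trialRatio ϑ μ m E), -residual ϑ ω μ (-1) m E]

/-- The increment `X' - X` is determined by two linear conditions: it must not change the value at
`m + 1`, and at `m + 2` it must cancel the residuals. Their determinant is the Casoratian of the
trial solutions. The coefficients `X` describe the values at `m` and `m + 1`, the coefficients `X'`
those at `m + 1` and `m + 2`. -/
theorem variation_of_constants {ϑ ω μ : ℝ} {m : ℕ} {E : ℂ}
    (hd : relCasoratian ϑ μ (m + 1) E ≠ 0) {X X' : Matrix (Fin 2) (Fin 2) ℂ}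
    (hX : X' = (1 + stepMat ϑ ω μ (m + 1) E) * X) (j : Fin 2) :
    X' 0 j * trialSol ϑ μ 1 (m + 1) E + X' 1 j * trialSol ϑ μ (-1) (m + 1) E =
      X 0 j * trialSol ϑ μ 1 (m + 1) E + X 1 j * trialSol ϑ μ (-1) (m + 1) E ∧
    (√((m : ℝ) + 2) : ℂ) *
      (X' 0 j * trialSol ϑ μ 1 (m + 2) E + X' 1 j * trialSol ϑ μ (-1) (m + 2) E) +
      (√((m : ℝ) + 1) : ℂ) *
      (X 0 j * trialSol ϑ μ 1 m E + X 1 j * trialSol ϑ μ (-1) m E) =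
      (√((m : ℝ) + 1) : ℂ) * midCoeff ϑ ω (m + 1) E *
      (X 0 j * trialSol ϑ μ 1 (m + 1) E + X 1 j * trialSol ϑ μ (-1) (m + 1) E) := by
  have hp := trialSol_residual ϑ ω μ 1 m E
  have hm := trialSol_residual ϑ ω μ (-1) m E
  have sp := trialSol_succ ϑ μ 1 (m + 1) E
  have sm := trialSol_succ ϑ μ (-1) (m + 1) E
  have np := trialSol_ne_zero ϑ μ 1 (m + 1) E
  have nm := trialSol_ne_zero ϑ μ (-1) (m + 1) E
  have hs : (√((m : ℝ) + 2) : ℂ) ≠ 0 := by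
    exact_mod_cast (Real.sqrt_pos.2 (show (0 : ℝ) < m + 2 by positivity)).ne'
  have x0 : X' 0 j = X 0 j + stepFactor ϑ μ (m + 1) E * (residual ϑ ω μ 1 (m + 1) E * X 0 j +
      residual ϑ ω μ (-1) (m + 1) E * (trialRatio ϑ μ (m + 1) E)⁻¹ * X 1 j) := by
    rw [hX]
    simp [add_mul, Matrix.mul_apply, Fin.sum_univ_two, stepMat]
    ring
  have x1 : X' 1 j = X 1 j - stepFactor ϑ μ (m + 1) E * (residual ϑ ω μ 1 (m + 1) E *
      trialRatio ϑ μ (m + 1) E * X 0 j + residual ϑ ω μ (-1) (m + 1) E * X 1 j) := by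
    rw [hX]
    simp [add_mul, Matrix.mul_apply, Fin.sum_univ_two, stepMat]
    ring
  have hK : (√((m : ℝ) + 2) : ℂ) * stepFactor ϑ μ (m + 1) E *
      relCasoratian ϑ μ (m + 1) E = √((m : ℝ) + 1) := by
    have e : ((m + 1 : ℕ) : ℝ) + 1 = m + 2 := by push_cast; ring
    rw [stepFactor, e]
    push_cast
    field_simp
  have hu : trialRatio ϑ μ (m + 1) E * trialSol ϑ μ (-1) (m + 1) E = trialSol ϑ μ 1 (m + 1) E :=
    div_mul_cancel₀ _ nm
  have hv : (trialRatio ϑ μ (m + 1) E)⁻¹ * trialSol ϑ μ 1 (m + 1) E =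
      trialSol ϑ μ (-1) (m + 1) E := by
    rw [trialRatio, inv_div]; exact div_mul_cancel₀ _ np
  rw [relCasoratian] at hK
  set a := trialSol ϑ μ 1 (m + 1) E
  set b := trialSol ϑ μ (-1) (m + 1) E
  set q := trialRatio ϑ μ (m + 1) E
  set q' := q⁻¹
  set rp := residual ϑ ω μ 1 (m + 1) E
  set rm := residual ϑ ω μ (-1) (m + 1) E
  set k := stepFactor ϑ μ (m + 1) E
  constructor
  · rw [x0, x1]
    linear_combination (-k * rp * X 0 j) * hu + (k * rm * X 1 j) * hv
  · set ep := Complex.exp (trialExp μ 1 E * logStep (m + 1) + Complex.I * (1 : ℝ) * ϑ)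
    set em := Complex.exp (trialExp μ (-1) E * logStep (m + 1) + Complex.I * (-1 : ℝ) * ϑ)
    set s2 := (√((m : ℝ) + 2) : ℂ)
    rw [sp] at hp ⊢
    rw [sm] at hm ⊢
    rw [x0, x1]
    linear_combination X 0 j * hp + X 1 j * hm - (a * rp * X 0 j + b * rm * X 1 j) * hK +
      (k * rm * X 1 j * s2 * ep) * hv - (k * rp * X 0 j * s2 * em) * hu

section Bounds

variable {ϑ ω μ : ℝ}

theorem inv_sq_nat_eq (m : ℕ) : ‖((m : ℂ)⁻¹ ^ 2)‖ = ((m : ℝ) ^ 2)⁻¹ := by simp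

theorem tendsto_relCasoratian (E₀ : ℂ) :
    Tendsto (fun x : ℕ × ℂ => relCasoratian ϑ μ x.1 x.2) (nearInfty E₀)
      (𝓝 (-(2 * Real.sin ϑ * Complex.I))) := by
  have key : ∀ τ : ℝ, Tendsto (fun x : ℕ × ℂ => Complex.exp (trialExp μ τ x.2 * logStep x.1 +
      Complex.I * τ * ϑ)) (nearInfty E₀) (𝓝 (Complex.exp (Complex.I * τ * ϑ))) := by
    intro τ
    have hp := continuous_trialExp μ τ
    have h0 := (((hp.tendsto E₀).comp (tendsto_snd (f := (atTop : Filter ℕ)))).mul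
      (tendsto_inv_fst E₀)).const_add 1
    have h1 := (exp_mul_logStep_isBigO (E₀ := E₀) hp logStep_isBigO).trans_tendsto
      (by simpa using (tendsto_inv_fst E₀).pow 2)
    have h2 := (h1.add h0).mul_const (Complex.exp (Complex.I * τ * ϑ))
    simpa [Complex.exp_add] using h2
  have e : Complex.exp (Complex.I * (-1 : ℝ) * ϑ) - Complex.exp (Complex.I * (1 : ℝ) * ϑ) =
      -(2 * Real.sin ϑ * Complex.I) := by
    rw [show Complex.I * (1 : ℝ) * ϑ = (ϑ : ℂ) * Complex.I by push_cast; ring,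
      show Complex.I * (-1 : ℝ) * ϑ = (-ϑ : ℂ) * Complex.I by push_cast; ring,
      Complex.exp_mul_I, Complex.exp_mul_I]
    simp
    ring
  rw [← e]
  exact (key (-1)).sub (key 1)

theorem neg_two_sin_mul_I_ne_zero (hϑ : Real.sin ϑ ≠ 0) :
    -(2 * (Real.sin ϑ : ℂ) * Complex.I) ≠ 0 := by
  have : (Real.sin ϑ : ℂ) ≠ 0 := by exact_mod_cast hϑ
  exact neg_ne_zero.2 (mul_ne_zero (mul_ne_zero two_ne_zero this) Complex.I_ne_zero)

theorem stepFactor_isBigO (hϑ : Real.sin ϑ ≠ 0) (E₀ : ℂ) :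
    (fun x : ℕ × ℂ => stepFactor ϑ μ x.1 x.2) =O[nearInfty E₀] fun _ => (1 : ℝ) := by
  have h1 : (fun x : ℕ × ℂ => ((√(x.1 : ℝ) / √((x.1 : ℝ) + 1) : ℝ) : ℂ)) =O[nearInfty E₀]
      fun _ => (1 : ℝ) := by
    refine IsBigO.of_bound 1 (Eventually.of_forall fun p => ?_)
    rw [Complex.norm_real, Real.norm_of_nonneg (by positivity), norm_one, mul_one]
    exact div_le_one_of_le₀ (Real.sqrt_le_sqrt (by linarith)) (by positivity)
  have h2 := ((tendsto_relCasoratian (ϑ := ϑ) (μ := μ) E₀).inv₀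
    (neg_two_sin_mul_I_ne_zero hϑ)).isBigO_one ℝ
  simpa [stepFactor, div_eq_mul_inv] using h1.mul h2

/-- The size `m^{-2μ Im E}` is the price of complex energies; it equals `1` for real `E`. -/
theorem norm_trialRatio {m : ℕ} {E : ℂ} :
    ‖trialRatio ϑ μ m E‖ = Real.exp (-(2 * μ * E.im) * Real.log m) := by
  rw [trialRatio, trialSol, trialSol, ← Complex.exp_sub, Complex.norm_exp]
  congr 1
  generalize Real.log (m : ℝ) = ℓ
  simp [trialExp]
  ring

theorem stepMat_eq (m : ℕ) (E : ℂ) :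
    stepMat ϑ ω μ m E =
      (stepFactor ϑ μ m E * residual ϑ ω μ 1 m E) • !![1, 0; 0, 0] +
      (stepFactor ϑ μ m E * (residual ϑ ω μ (-1) m E * (trialRatio ϑ μ m E)⁻¹)) • !![0, 1; 0, 0] +
      (stepFactor ϑ μ m E * (residual ϑ ω μ 1 m E * trialRatio ϑ μ m E)) • !![0, 0; -1, 0] +
      (stepFactor ϑ μ m E * residual ϑ ω μ (-1) m E) • !![0, 0; 0, -1] := by
  ext i j
  fin_cases i <;> fin_cases j <;> simp [stepMat]

attribute [local instance] Matrix.linftyOpNormedRing Matrix.linftyOpNormedAlgebra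

/-- Common form of the two bounds below: the off-diagonal entries carry the ratio of the trial
solutions or its inverse, and `g` dominates both. Restricting the filter allows a fixed real energy.
-/
theorem stepMat_isBigO_of_ratio (hω : 0 < ω) (hμ : 2 * ω * μ * Real.sin ϑ = Real.cos ϑ)
    (hϑ : Real.sin ϑ ≠ 0) {E₀ : ℂ} {l : Filter (ℕ × ℂ)} (hl : l ≤ nearInfty E₀)
    {g : ℕ × ℂ → ℝ} (hg : (fun _ => (1 : ℝ)) =O[l] g)
    (h1 : (fun x : ℕ × ℂ => trialRatio ϑ μ x.1 x.2) =O[l] g)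
    (h2 : (fun x : ℕ × ℂ => (trialRatio ϑ μ x.1 x.2)⁻¹) =O[l] g) :
    (fun x : ℕ × ℂ => stepMat ϑ ω μ x.1 x.2) =O[l] fun x => ((x.1 : ℝ) ^ 2)⁻¹ * g x := by
  have hr : ∀ τ : ℝ, τ = 1 ∨ τ = -1 → (fun x : ℕ × ℂ => residual ϑ ω μ τ x.1 x.2) =O[l]
      fun x => ((x.1 : ℝ) ^ 2)⁻¹ := fun τ hτ =>
    ((residual_isBigO (E₀ := E₀) hω hτ hμ).mono hl).trans
      (IsBigO.of_bound 1 (Eventually.of_forall fun p => by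
        rw [inv_sq_nat_eq, one_mul]; exact le_abs_self _))
  have hf := (stepFactor_isBigO (μ := μ) hϑ E₀).mono hl
  have hone : ∀ {f : ℕ × ℂ → ℂ}, f =O[l] (fun x => ((x.1 : ℝ) ^ 2)⁻¹) →
      f =O[l] fun x => ((x.1 : ℝ) ^ 2)⁻¹ * g x := fun h => by
    simpa using h.trans ((isBigO_refl _ _).mul hg |>.congr_left fun x => mul_one _)
  have hsm : ∀ {f : ℕ × ℂ → ℂ} (A : Matrix (Fin 2) (Fin 2) ℂ),
      f =O[l] (fun x => ((x.1 : ℝ) ^ 2)⁻¹ * g x) →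
      (fun x => (stepFactor ϑ μ x.1 x.2 * f x) • A) =O[l] fun x => ((x.1 : ℝ) ^ 2)⁻¹ * g x := by
    intro f A h
    have := (hf.mul h).smul ((isBigO_const_const A (one_ne_zero (α := ℝ)) l))
    simpa using this
  simp only [stepMat_eq]
  exact (((hsm _ (hone (hr 1 (Or.inl rfl)))).add (hsm _ ((hr (-1) (Or.inr rfl)).mul h2))).add
    (hsm _ ((hr 1 (Or.inl rfl)).mul h1))).add (hsm _ (hone (hr (-1) (Or.inr rfl))))

theorem stepMat_isBigO_near (hω : 0 < ω) (hμ : 2 * ω * μ * Real.sin ϑ = Real.cos ϑ)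
    (hϑ : Real.sin ϑ ≠ 0) (E₀ : ℝ) :
    (fun x : ℕ × ℂ => stepMat ϑ ω μ x.1 x.2) =O[nearInfty E₀] fun x => (x.1 : ℝ) ^ (-(3 / 2) : ℝ) := by
  -- With this strip the ratio costs at most `√m`, and `m⁻² √m = m^{-3/2}` is still summable.
  have hev : ∀ᶠ x : ℕ × ℂ in nearInfty E₀, 1 ≤ x.1 ∧ |2 * μ * x.2.im| < 1 / 2 := by
    have hc : Continuous fun E : ℂ => |2 * μ * E.im| := by fun_prop
    exact (eventually_ge_atTop 1).prod_mk
      ((hc.tendsto (E₀ : ℂ)).eventually_lt_const (show _ < (1 / 2 : ℝ) by simp))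
  have hexp : ∀ {m : ℕ} {y : ℝ}, 1 ≤ m → |y| < 1 / 2 → Real.exp (y * Real.log m) ≤ √(m : ℝ) := by
    intro m y hm hy
    have hm0 : (0 : ℝ) < m := by exact_mod_cast hm
    rw [Real.sqrt_eq_rpow, Real.rpow_def_of_pos hm0, mul_comm (Real.log _)]
    have := Real.log_nonneg (show (1 : ℝ) ≤ m by exact_mod_cast hm)
    have := (abs_lt.1 hy).2
    gcongr
  have := stepMat_isBigO_of_ratio hω hμ hϑ (l := nearInfty E₀) le_rfl
    (g := fun x => √(x.1 : ℝ)) ?_ ?_ ?_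
  · refine this.congr' EventuallyEq.rfl ?_
    filter_upwards [hev] with p hp
    have hp0 : (0 : ℝ) < p.1 := by exact_mod_cast hp.1
    rw [Real.sqrt_eq_rpow, ← Real.rpow_natCast, ← Real.rpow_neg hp0.le, ← Real.rpow_add hp0]
    norm_num
  · refine IsBigO.of_bound 1 ?_
    filter_upwards [hev] with p hp
    have : (1 : ℝ) ≤ p.1 := by exact_mod_cast hp.1
    rw [norm_one, one_mul, Real.norm_of_nonneg (by positivity)]
    exact Real.one_le_sqrt.2 this
  · refine IsBigO.of_bound 1 ?_
    filter_upwards [hev] with p hp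
    rw [norm_trialRatio, one_mul, Real.norm_of_nonneg (by positivity)]
    exact hexp hp.1 (by rw [abs_neg]; exact hp.2)
  · refine IsBigO.of_bound 1 ?_
    filter_upwards [hev] with p hp
    rw [norm_inv, norm_trialRatio, ← Real.exp_neg, one_mul, Real.norm_of_nonneg (by positivity),
      ← neg_mul, neg_neg]
    exact hexp hp.1 hp.2

theorem stepMat_isBigO_real (hω : 0 < ω) (hμ : 2 * ω * μ * Real.sin ϑ = Real.cos ϑ)
    (hϑ : Real.sin ϑ ≠ 0) (E : ℝ) :
    (fun n : ℕ => stepMat ϑ ω μ n E) =O[atTop] fun n : ℕ => ((n : ℝ) ^ 2)⁻¹ := by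
  have ht : Tendsto (fun n : ℕ => (n, (E : ℂ))) atTop (nearInfty E) :=
    tendsto_id.prodMk tendsto_const_nhds
  have hn : ∀ n : ℕ, ‖trialRatio ϑ μ n E‖ = 1 := fun n => by simp [norm_trialRatio]
  have := stepMat_isBigO_of_ratio hω hμ hϑ (l := map (fun n : ℕ => (n, (E : ℂ))) atTop) ht
    (g := fun _ => 1) (isBigO_refl _ _)
    (IsBigO.of_bound 1 (eventually_map.2 (Eventually.of_forall fun n => by simp [hn])))
    (IsBigO.of_bound 1 (eventually_map.2 (Eventually.of_forall fun n => by simp [hn])))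
  simpa [Function.comp_def] using isBigO_map.1 this

theorem eventually_differentiableAt_stepMat (hω : 0 < ω) (hϑ : Real.sin ϑ ≠ 0) (E₀ : ℂ) :
    ∀ᶠ x : ℕ × ℂ in nearInfty E₀, DifferentiableAt ℂ (stepMat ϑ ω μ x.1) x.2 ∧
      relCasoratian ϑ μ x.1 x.2 ≠ 0 := by
  have h1 : Tendsto (fun x : ℕ × ℂ => 1 + (1 / 2 - x.2 / (ω : ℂ)) / x.1) (nearInfty E₀) (𝓝 1) := by
    have hc : Continuous fun E : ℂ => 1 / 2 - E / (ω : ℂ) := by fun_prop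
    have := (((hc.tendsto E₀).comp (tendsto_snd (f := (atTop : Filter ℕ)))).mul
      (tendsto_inv_fst E₀)).const_add 1
    simpa [div_eq_mul_inv] using this
  have h2 : Tendsto (fun x : ℕ × ℂ => 1 + expWave ω x.1 x.2) (nearInfty E₀) (𝓝 (1 + 0)) :=
    ((expWave_isBigO (E₀ := E₀) hω).trans_tendsto
      (by simpa using (tendsto_inv_fst E₀).pow 2)).const_add 1
  filter_upwards [h1.eventually (Complex.isOpen_slitPlane.mem_nhds Complex.one_mem_slitPlane),
    h2.eventually_ne (show (1 : ℂ) + 0 ≠ 0 by norm_num),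
    (tendsto_relCasoratian (ϑ := ϑ) (μ := μ) E₀).eventually_ne
      (neg_two_sin_mul_I_ne_zero hϑ)] with p hp1 hp2 hp3
  refine ⟨?_, hp3⟩
  have dexp : ∀ τ : ℝ, Differentiable ℂ (trialExp μ τ) := fun τ => by unfold trialExp; fun_prop
  have dw : DifferentiableAt ℂ (relWave ω p.1) p.2 := by
    unfold relWave
    have : DifferentiableAt ℂ (fun E : ℂ => 1 + (1 / 2 - E / (ω : ℂ)) / p.1) p.2 := by fun_prop
    exact ((this.clog hp1).const_mul _).cexp
  have de : DifferentiableAt ℂ (expWave ω p.1) p.2 := by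
    unfold expWave
    exact (dw.const_mul _).cexp
  have dm : DifferentiableAt ℂ (midCoeff ϑ ω p.1) p.2 := by
    unfold midCoeff
    exact (dw.mul ((de.const_sub 1).div (de.const_add 1) hp2)).const_mul _
  have dr : ∀ τ : ℝ, DifferentiableAt ℂ (residual ϑ ω μ τ p.1) p.2 := by
    intro τ
    have := dexp τ
    unfold residual
    refine DifferentiableAt.sub ?_ dm
    fun_prop
  have dq : DifferentiableAt ℂ (trialRatio ϑ μ p.1) p.2 := by
    have h1 := dexp 1
    have h2 := dexp (-1)
    unfold trialRatio
    refine DifferentiableAt.div ?_ ?_ (trialSol_ne_zero _ _ _ _ _)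
    · unfold trialSol; fun_prop
    · unfold trialSol; fun_prop
  have hq0 : trialRatio ϑ μ p.1 p.2 ≠ 0 :=
    div_ne_zero (trialSol_ne_zero _ _ _ _ _) (trialSol_ne_zero _ _ _ _ _)
  have dk : DifferentiableAt ℂ (stepFactor ϑ μ p.1) p.2 := by
    have h1 := dexp 1
    have h2 := dexp (-1)
    unfold stepFactor
    refine DifferentiableAt.div (differentiableAt_const _) ?_ hp3
    unfold relCasoratian
    fun_prop
  have e : stepMat ϑ ω μ p.1 = _ := funext (stepMat_eq p.1)
  rw [e]
  exact ((((dk.mul (dr 1)).smul_const _).add ((dk.mul ((dr (-1)).mul (dq.inv hq0))).smul_const _)).add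
    ((dk.mul ((dr 1).mul dq)).smul_const _)).add ((dk.mul (dr (-1))).smul_const _)

end Bounds
end
end OscillatorRing

/-! ### Holomorphic solutions of the reduced recurrence. -/

namespace OscillatorRing
open Filter Topology Asymptotics

noncomputable section

section LocalSolution

variable {ϑ ω μ : ℝ}

theorem norm_trialSol_ofReal (τ : ℝ) {n : ℕ} (hn : 1 ≤ n) (E : ℝ) :
    ‖trialSol ϑ μ τ n E‖ = (n : ℝ) ^ (-(1 / 4) : ℝ) := by
  have hn0 : (0 : ℝ) < n := by exact_mod_cast hn
  rw [trialSol, Complex.norm_exp, Real.rpow_def_of_pos hn0]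
  congr 1
  generalize Real.log (n : ℝ) = ℓ
  simp [trialExp]
  ring

attribute [local instance] Matrix.linftyOpNormedRing Matrix.linftyOpNormedAlgebra

theorem entry_isBigO {ι : Type*} {l : Filter ι} {F : ι → Matrix (Fin 2) (Fin 2) ℂ} {g : ι → ℝ}
    (h : F =O[l] g) (i j : Fin 2) : (fun x => F x i j) =O[l] g :=
  ((LinearMap.toContinuousLinearMap (Matrix.entryLinearMap ℂ ℂ i j)).isBigO_comp F l).trans h

theorem differentiableOn_entry {V : Set ℂ} {F : ℂ → Matrix (Fin 2) (Fin 2) ℂ}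
    (h : DifferentiableOn ℂ F V) (i j : Fin 2) : DifferentiableOn ℂ (fun x => F x i j) V :=
  (LinearMap.toContinuousLinearMap (Matrix.entryLinearMap ℂ ℂ i j)).differentiable.comp_differentiableOn h

/-- The first column of the normalized matrix tends to `(1, 0)`, so the combination of trial
solutions that it defines is asymptotic to the trial solution with `τ = 1`. Holomorphy uses the
weaker complex bound, the rate the sharper real one. -/
theorem exists_reduced_solution_near (hω : 0 < ω) (hμ : 2 * ω * μ * Real.sin ϑ = Real.cos ϑ)
    (hϑ : Real.sin ϑ ≠ 0) (E₀ : ℝ) :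
    ∃ V : Set ℂ, IsOpen V ∧ (E₀ : ℂ) ∈ V ∧ ∃ (N : ℕ) (Y : ℕ → ℂ → ℂ),
      (∀ n, DifferentiableOn ℂ (Y n) V) ∧
      (∀ n ≥ N, ∀ E ∈ V, (√((n : ℝ) + 2) : ℂ) * Y (n + 2) E + (√((n : ℝ) + 1) : ℂ) * Y n E =
        (√((n : ℝ) + 1) : ℂ) * midCoeff ϑ ω (n + 1) E * Y (n + 1) E) ∧
      ∀ E : ℝ, (E : ℂ) ∈ V → (fun n => Y n E - trialSol ϑ μ 1 n E) =O[atTop]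
        fun n : ℕ => (n : ℝ)⁻¹ * (n : ℝ) ^ (-(1 / 4) : ℝ) := by
  obtain ⟨K, hK0, hK⟩ := (stepMat_isBigO_near hω hμ hϑ E₀).exists_nonneg
  obtain ⟨pa, ha, pb, hb, hab⟩ := eventually_prod_iff.1
    (hK.bound.and (eventually_differentiableAt_stepMat (μ := μ) hω hϑ (E₀ : ℂ)))
  obtain ⟨N, hN⟩ := eventually_atTop.1 ha
  obtain ⟨V, hVb, hVo, hEV⟩ := eventually_nhds_iff.1 hb
  obtain ⟨N', hN', X, hXd, hXr, hXl⟩ := exists_normalized_solution hVo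
    (M := stepMat ϑ ω μ) (g := fun n : ℕ => K * (n : ℝ) ^ (-(3 / 2) : ℝ)) (N := N)
    ((Real.summable_nat_rpow.2 (by norm_num)).mul_left K) (fun n => by positivity)
    (fun n hn E hE => (hab (hN n hn) (hVb E hE)).2.1.differentiableWithinAt)
    (fun n hn E hE => by
      have := (hab (hN n hn) (hVb E hE)).1
      rwa [Real.norm_of_nonneg (by positivity)] at this)
  -- The threshold is raised by one because the recurrence at `n` uses the matching of values at
  -- `n`, which is the step indexed by `n - 1` in `variation_of_constants`.
  refine ⟨V, hVo, hEV, N' + 1, fun n E => X n E 0 0 * trialSol ϑ μ 1 n E +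
    X n E 1 0 * trialSol ϑ μ (-1) n E, ?_, ?_, ?_⟩
  · intro n
    have hu : ∀ τ : ℝ, Differentiable ℂ (trialSol ϑ μ τ n) := fun τ => by
      unfold trialSol trialExp; fun_prop
    exact ((differentiableOn_entry (hXd n) 0 0).mul (hu 1).differentiableOn).add
      ((differentiableOn_entry (hXd n) 1 0).mul (hu (-1)).differentiableOn)
  · intro n hn E hE
    obtain ⟨k, rfl⟩ := Nat.exists_eq_add_of_le' (show 1 ≤ n by omega)
    have h1 := (variation_of_constants (hab (hN (k + 1) (by omega)) (hVb E hE)).2.2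
      (hXr (k + 1) (by omega) E hE) 0).1
    have h2 := (variation_of_constants (hab (hN (k + 1 + 1) (by omega)) (hVb E hE)).2.2
      (hXr (k + 1 + 1) (by omega) E hE) 0).2
    dsimp only at h1 h2 ⊢
    linear_combination h2 - (√(((k + 1 : ℕ) : ℝ) + 1) : ℂ) * h1
  · intro E hE
    have hl := hXl E hE
    have hstep : (fun n => X (n + 1) E - X n E) =O[atTop] fun n : ℕ => ((n : ℝ) ^ 2)⁻¹ := by
      have := (stepMat_isBigO_real hω hμ hϑ E).mul (hl.isBigO_one ℝ)
      refine (this.congr' ?_ (Eventually.of_forall fun n => mul_one _))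
      filter_upwards [eventually_ge_atTop N'] with n hn
      rw [hXr n hn E hE, add_mul, one_mul, add_sub_cancel_left]
    have hX := isBigO_inv_of_isBigO_sub hl hstep
    have hu : ∀ τ, (fun n : ℕ => trialSol ϑ μ τ n E) =O[atTop]
        fun n : ℕ => (n : ℝ) ^ (-(1 / 4) : ℝ) := fun τ => by
      refine IsBigO.of_bound 1 ?_
      filter_upwards [eventually_ge_atTop 1] with n hn
      rw [norm_trialSol_ofReal τ hn, one_mul]
      exact le_abs_self _
    refine (((entry_isBigO hX 0 0).mul (hu 1)).add
      ((entry_isBigO hX 1 0).mul (hu (-1)))).congr_left fun n => ?_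
    simp
    ring

end LocalSolution

/-! ### From the reduced recurrence back to the original one at real energies. -/

section RealCoefficients

variable {ω E : ℝ}

theorem neg_waveNumberSq_eq (hω : 0 < ω) {n : ℕ} (hn : 1 ≤ n) :
    -waveNumberSq ω n E = 2 * ω * n * (1 + (1 / 2 - E / ω) / n) := by
  have : (n : ℝ) ≠ 0 := by positivity
  simp only [waveNumberSq, Int.cast_natCast]
  field_simp
  ring

theorem relWave_ofReal (hω : 0 < ω) {n : ℕ} (hn : 1 ≤ n) (h : waveNumberSq ω n E < 0) :
    0 < √(1 + (1 / 2 - E / ω) / n) ∧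
    relWave ω n E = (√(1 + (1 / 2 - E / ω) / n) : ℝ) ∧
    √(-waveNumberSq ω n E) = √(2 * ω * n) * √(1 + (1 / 2 - E / ω) / n) := by
  have hn0 : (0 : ℝ) < n := by exact_mod_cast hn
  have e := neg_waveNumberSq_eq (E := E) hω hn
  have hy : 0 < 1 + (1 / 2 - E / ω) / n := by
    by_contra hc
    have := mul_nonpos_of_nonneg_of_nonpos (show 0 ≤ 2 * ω * n by positivity) (not_lt.1 hc)
    linarith
  refine ⟨Real.sqrt_pos.2 hy, ?_, by rw [e, Real.sqrt_mul (by positivity)]⟩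
  rw [relWave, Real.sqrt_eq_rpow, Real.rpow_def_of_pos hy, mul_comm]
  push_cast [Complex.ofReal_log hy.le]
  rfl

theorem expWave_ofReal (hω : 0 < ω) {n : ℕ} (hn : 1 ≤ n) (h : waveNumberSq ω n E < 0) :
    expWave ω n E = (Real.exp (-(2 * Real.pi * √(-waveNumberSq ω n E))) : ℝ) := by
  obtain ⟨-, h1, h2⟩ := relWave_ofReal hω hn h
  rw [expWave, h1, h2]
  push_cast
  congr 1
  ring

theorem tanh_eq_exp (x : ℝ) :
    Real.tanh (x * Real.pi) =
      (1 - Real.exp (-(2 * Real.pi * x))) / (1 + Real.exp (-(2 * Real.pi * x))) := by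
  have h : Real.exp (-(x * Real.pi)) * Real.exp (x * Real.pi) = 1 := by
    rw [← Real.exp_add]; simp
  have e : Real.exp (-(2 * Real.pi * x)) = Real.exp (-(x * Real.pi)) * Real.exp (-(x * Real.pi)) := by
    rw [← Real.exp_add]; congr 1; ring
  rw [Real.tanh_eq_sinh_div_cosh, Real.sinh_eq, Real.cosh_eq, e]
  set a := Real.exp (x * Real.pi)
  set b := Real.exp (-(x * Real.pi))
  have ha : 0 < a := Real.exp_pos _
  have hb : 0 < b := Real.exp_pos _
  rw [div_eq_div_iff (by positivity) (by positivity)]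
  linear_combination b * h

theorem inv_cosh_sq_eq_exp (x : ℝ) :
    (Real.cosh (x * Real.pi) ^ 2)⁻¹ =
      4 * Real.exp (-(2 * Real.pi * x)) / (1 + Real.exp (-(2 * Real.pi * x))) ^ 2 := by
  have h : Real.exp (-(x * Real.pi)) * Real.exp (x * Real.pi) = 1 := by
    rw [← Real.exp_add]; simp
  have e : Real.exp (-(2 * Real.pi * x)) = Real.exp (-(x * Real.pi)) * Real.exp (-(x * Real.pi)) := by
    rw [← Real.exp_add]; congr 1; ring
  rw [Real.cosh_eq, e]
  set a := Real.exp (x * Real.pi)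
  set b := Real.exp (-(x * Real.pi))
  have ha : 0 < a := Real.exp_pos _
  have hb : 0 < b := Real.exp_pos _
  have : a = b⁻¹ := by field_simp; linarith
  rw [this]
  field_simp
  norm_num

theorem sqrt_mul_midCoeff_ofReal (ϑ : ℝ) (hω : 0 < ω) {n : ℕ} (hn : 1 ≤ n)
    (h : waveNumberSq ω n E < 0) :
    (√(n : ℝ) : ℂ) * midCoeff ϑ ω n E = (2 * Real.cos ϑ / √(2 * ω) *
      (√(-waveNumberSq ω n E) * Real.tanh (√(-waveNumberSq ω n E) * Real.pi)) : ℝ) := by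
  obtain ⟨-, h1, h2⟩ := relWave_ofReal hω hn h
  rw [midCoeff, h1, expWave_ofReal hω hn h, tanh_eq_exp]
  norm_cast
  set T := (1 - Real.exp (-(2 * Real.pi * √(-waveNumberSq ω n E)))) /
    (1 + Real.exp (-(2 * Real.pi * √(-waveNumberSq ω n E))))
  rw [h2, Real.sqrt_mul (show 0 ≤ 2 * ω by positivity)]
  have : √(2 * ω) ≠ 0 := by positivity
  field_simp

theorem derivWithin_v_eq_neg_mul (n : ℤ) (h : waveNumberSq ω n E < 0) :
    derivWithin (fun x => v ω n E x) (Set.Ioi 0) 0 =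
      -(√(-waveNumberSq ω n E) * Real.tanh (√(-waveNumberSq ω n E) * Real.pi) * v ω n E 0) := by
  rw [derivWithin_v_of_neg h, v_zero_of_neg h, Real.tanh_eq_sinh_div_cosh]
  have := (Real.cosh_pos (√(-waveNumberSq ω n E) * Real.pi)).ne'
  field_simp

/-- Dividing by `v_n(0)` removes the normalizations: `v'_{n+1}(0+)/v_{n+1}(0) = -χ tanh(πχ)` is all
that is left of the middle term. The factor `κ` is free, and is used later to normalize the
asymptotics. -/
theorem recurrence_of_reduced {α s ϑ : ℝ} (hω : 0 < ω) (hα : α ≠ 0)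
    (hϑ : Real.cos ϑ = s * ω / α) {n : ℕ} (hn0 : waveNumberSq ω n E < 0)
    (hn1 : waveNumberSq ω (n + 1 : ℕ) E < 0) (hn2 : waveNumberSq ω (n + 2 : ℕ) E < 0) (κ : ℂ)
    {y : ℕ → ℂ} (hy : (√((n : ℝ) + 2) : ℂ) * y (n + 2) + (√((n : ℝ) + 1) : ℂ) * y n =
      (√((n : ℝ) + 1) : ℂ) * midCoeff ϑ ω (n + 1) E * y (n + 1)) :
    (h₂ α ω n E : ℂ) * (κ / (v ω (n + 2 : ℕ) E 0 : ℂ) * y (n + 2)) +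
      (s : ℂ) * (h₁ ω n E : ℂ) * (κ / (v ω (n + 1 : ℕ) E 0 : ℂ) * y (n + 1)) +
      (h₀ α ω n E : ℂ) * (κ / (v ω n E 0 : ℂ) * y n) = 0 := by
  have v0 : (v ω n E 0 : ℂ) ≠ 0 := by exact_mod_cast (v_zero_pos_of_neg hn0).ne'
  have v1 : (v ω (n + 1 : ℕ) E 0 : ℂ) ≠ 0 := by exact_mod_cast (v_zero_pos_of_neg hn1).ne'
  have v2 : (v ω (n + 2 : ℕ) E 0 : ℂ) ≠ 0 := by exact_mod_cast (v_zero_pos_of_neg hn2).ne'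
  have hm := sqrt_mul_midCoeff_ofReal ϑ hω (show 1 ≤ n + 1 by omega) hn1
  have e2 : h₂ α ω n E = α * √((n : ℝ) + 2) * v ω (n + 2 : ℕ) E 0 := by simp [h₂]
  have e1 : h₁ ω n E = √(2 * ω) * derivWithin (fun x => v ω (n + 1 : ℕ) E x) (Set.Ioi 0) 0 := by
    simp [h₁]
  have e0 : h₀ α ω n E = α * √((n : ℝ) + 1) * v ω n E 0 := by simp [h₀]
  rw [e2, e1, e0, derivWithin_v_eq_neg_mul _ hn1]
  set b := √(-waveNumberSq ω (n + 1 : ℕ) E) *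
    Real.tanh (√(-waveNumberSq ω (n + 1 : ℕ) E) * Real.pi) with hb
  have hm' : (√((n : ℝ) + 1) : ℂ) * midCoeff ϑ ω (n + 1) E = (s / α * √(2 * ω) * b : ℝ) := by
    have hc : ((n + 1 : ℕ) : ℝ) = (n : ℝ) + 1 := by push_cast; rfl
    rw [← hc, hm]
    congr 1
    have h2 : √(2 * ω) * √(2 * ω) = 2 * ω := Real.mul_self_sqrt (by positivity)
    have h3 : √(2 * ω) ≠ 0 := by positivity
    rw [hϑ]
    field_simp
    rw [sq, h2]
    ring
  rw [hm'] at hy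
  generalize v ω (n + 1 : ℕ) E 0 = V₁ at *
  generalize v ω (n + 2 : ℕ) E 0 = V₂ at *
  have hα' : (α : ℂ) ≠ 0 := by exact_mod_cast hα
  push_cast at hy ⊢
  field_simp at hy ⊢
  linear_combination κ * hy

theorem v_zero_isBigO (hω : 0 < ω) (E : ℝ) :
    (fun n : ℕ => √√(2 * ω) * √√(n : ℝ) / v ω n E 0 - 1) =O[atTop] fun n : ℕ => (n : ℝ)⁻¹ := by
  have ht : Tendsto (fun n : ℕ => (n, (E : ℂ))) atTop (nearInfty E) :=
    tendsto_id.prodMk tendsto_const_nhds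
  obtain ⟨N, hN⟩ := exists_forall_waveNumberSq_neg hω (E + 1)
  let w : ℕ → ℝ := fun n => √(1 + (1 / 2 - E / ω) / n)
  let t : ℕ → ℝ := fun n => Real.exp (-(2 * Real.pi * √(-waveNumberSq ω n E)))
  have hev : ∀ᶠ n : ℕ in atTop, 1 ≤ n ∧ waveNumberSq ω n E < 0 := by
    filter_upwards [eventually_ge_atTop (N + 1)] with n hn
    exact ⟨by omega, hN n (by omega) E (by linarith)⟩
  have hnorm : (fun n : ℕ => ((n : ℂ))⁻¹ ^ 2) =O[atTop] fun n : ℕ => (n : ℝ)⁻¹ ^ 2 :=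
    IsBigO.of_bound 1 (Eventually.of_forall fun n => by simp)
  have htO : t =O[atTop] fun n : ℕ => (n : ℝ)⁻¹ ^ 2 := by
    refine (((expWave_isBigO (E₀ := (E : ℂ)) hω).comp_tendsto ht).norm_left.congr' ?_
      EventuallyEq.rfl).trans hnorm
    filter_upwards [hev] with n hn
    simp only [Function.comp]
    rw [expWave_ofReal hω hn.1 hn.2, Complex.norm_real, Real.norm_of_nonneg (Real.exp_pos _).le]
  have hinv0 : Tendsto (fun n : ℕ => (n : ℝ)⁻¹) atTop (𝓝 0) := tendsto_inv_atTop_nhds_zero_nat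
  have hsq : (fun n : ℕ => (n : ℝ)⁻¹ ^ 2) =O[atTop] fun n : ℕ => (n : ℝ)⁻¹ := by
    simpa [sq] using (isBigO_refl (fun n : ℕ => (n : ℝ)⁻¹) atTop).mul (hinv0.isBigO_one ℝ)
  have hwO : (fun n => w n - 1) =O[atTop] fun n : ℕ => (n : ℝ)⁻¹ := by
    have h1 := ((relWave_isBigO (E₀ := (E : ℂ)) ω).comp_tendsto ht).trans hnorm
    have h2 : (fun n : ℕ => 1 / 2 * (1 / 2 - (E : ℂ) / ω) * ((n : ℂ))⁻¹) =O[atTop]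
        fun n : ℕ => (n : ℝ)⁻¹ :=
      IsBigO.const_mul_left
        (IsBigO.of_bound 1 (Eventually.of_forall fun n => by simp)) _
    have h3 := ((h1.trans hsq).add h2).norm_left
    refine IsBigO.of_norm_left (h3.congr' ?_ EventuallyEq.rfl)
    filter_upwards [hev] with n hn
    simp only [Function.comp]
    rw [(relWave_ofReal hω hn.1 hn.2).2.1, ← Complex.norm_real]
    congr 1
    simp only [w]
    push_cast
    ring
  have ht0 : Tendsto t atTop (𝓝 0) := htO.trans_tendsto (by simpa using hinv0.pow 2)
  have hw1 : Tendsto w atTop (𝓝 1) := by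
    simpa using (hwO.trans_tendsto hinv0).add_const 1
  have hst : (fun n : ℕ => √(2 * ω * n) * t n) =O[atTop] fun n : ℕ => (n : ℝ)⁻¹ := by
    have : (fun n : ℕ => √(2 * ω * n)) =O[atTop] fun n : ℕ => (n : ℝ) := by
      refine IsBigO.of_bound (√(2 * ω)) ?_
      filter_upwards [eventually_ge_atTop 1] with n hn
      have : (1 : ℝ) ≤ n := by exact_mod_cast hn
      rw [Real.sqrt_mul (by positivity), Real.norm_of_nonneg (by positivity),
        Real.norm_of_nonneg (by positivity)]
      gcongr
      exact Real.sqrt_le_iff.2 ⟨by positivity, by nlinarith⟩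
    refine (this.mul htO).congr' EventuallyEq.rfl ?_
    filter_upwards [eventually_ge_atTop 1] with n hn
    have : (n : ℝ) ≠ 0 := by positivity
    field_simp
  have g1 : Tendsto (fun n => -((1 - t n) / (1 + t n)) / w n) atTop (𝓝 (-((1 - 0) / (1 + 0)) / 1)) :=
    (((ht0.const_sub 1).div (ht0.const_add 1) (by norm_num)).neg).div hw1 one_ne_zero
  have g2 : Tendsto (fun n => -2 / (1 + t n)) atTop (𝓝 (-2 / (1 + 0))) :=
    tendsto_const_nhds.div (ht0.const_add 1) (by norm_num)
  have g3 : Tendsto (fun n => Real.pi * 4 / (1 + t n) ^ 2) atTop (𝓝 (Real.pi * 4 / (1 + 0) ^ 2)) :=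
    tendsto_const_nhds.div ((ht0.const_add 1).pow 2) (by norm_num)
  have hsum := (((g1.isBigO_one ℝ).mul hwO).add ((g2.isBigO_one ℝ).mul (htO.trans hsq))).add
    ((g3.isBigO_one ℝ).mul hst)
  simp only [one_mul] at hsum
  refine (IsBigO.of_bound 1 ?_).trans hsum
  filter_upwards [hev] with n hn
  obtain ⟨hw0, -, hχ⟩ := relWave_ofReal hω hn.1 hn.2
  have hn0 : (0 : ℝ) < n := by exact_mod_cast hn.1
  have hv := v_zero_pos_of_neg hn.2
  set r := √√(2 * ω) * √√(n : ℝ) / v ω n E 0 with hr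
  have hr0 : 0 < r := by positivity
  -- Exact consequence of `v_n(0)⁻² = π / cosh²(πχ) + tanh(πχ)/χ`, split into bounded factors times
  -- small ones. As `r > 0`, one has `|r - 1| ≤ |r² - 1|`.
  have hr2 : r ^ 2 - 1 = -((1 - t n) / (1 + t n)) / w n * (w n - 1) + -2 / (1 + t n) * t n +
      Real.pi * 4 / (1 + t n) ^ 2 * (√(2 * ω * n) * t n) := by
    have htn : 0 < t n := Real.exp_pos _
    have hc : 0 < Real.cosh (√(-waveNumberSq ω n E) * Real.pi) := Real.cosh_pos _
    have hχ0 : 0 < √(-waveNumberSq ω n E) := Real.sqrt_pos.2 (by linarith [hn.2])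
    have hinv : (v ω n E 0 ^ 2)⁻¹ = Real.pi * (4 * t n / (1 + t n) ^ 2) +
        (1 - t n) / (1 + t n) / √(-waveNumberSq ω n E) := by
      rw [← inv_cosh_sq_eq_exp, ← tanh_eq_exp, v_zero_of_neg hn.2, mul_pow, inv_pow,
        Real.sq_sqrt (add_sinh_div_pos hχ0).le, Real.tanh_eq_sinh_div_cosh,
        show 2 * √(-waveNumberSq ω n E) * Real.pi = 2 * (√(-waveNumberSq ω n E) * Real.pi) by ring,
        Real.sinh_two_mul]
      field_simp
    have h4 : r ^ 2 = √(2 * ω * n) * (v ω n E 0 ^ 2)⁻¹ := by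
      rw [hr, div_pow, mul_pow, Real.sq_sqrt (by positivity), Real.sq_sqrt (by positivity),
        Real.sqrt_mul (show 0 ≤ 2 * ω by positivity) (n : ℝ), div_eq_mul_inv]
    have hq : 0 < √(2 * ω * n) := by positivity
    have hw0' : 0 < w n := hw0
    have hχ' : √(-waveNumberSq ω n E) = √(2 * ω * n) * w n := hχ
    rw [h4, hinv, hχ']
    field_simp
    ring
  rw [← hr2, one_mul, Real.norm_eq_abs, Real.norm_eq_abs,
    show r ^ 2 - 1 = (r - 1) * (r + 1) by ring, abs_mul]
  refine le_mul_of_one_le_right (abs_nonneg _) ?_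
  rw [abs_of_pos (by linarith)]
  linarith

end RealCoefficients
end
end OscillatorRing

/-! ### Normal solutions: existence, Casoratian, uniqueness. -/

namespace OscillatorRing
open Filter Topology Asymptotics
open scoped ComplexConjugate

noncomputable section

variable {α ω s : ℝ}

theorem cos_θ (hω : 0 < ω) (hα : ω < α) (hs : s = 1 ∨ s = -1) :
    Real.cos (θ α ω s) = s * ω / α := by
  have h1 : ω / α ≤ 1 := (div_le_one (hω.trans hα)).2 hα.le
  have h2 : 0 < ω / α := div_pos hω (hω.trans hα)
  have h3 : 1 * ω / α = ω / α := by ring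
  have h4 : -1 * ω / α = -(ω / α) := by ring
  refine Real.cos_arccos ?_ ?_ <;> rcases hs with rfl | rfl <;> linarith

theorem sin_θ (hω : 0 < ω) (hα : ω < α) (hs : s = 1 ∨ s = -1) :
    Real.sin (θ α ω s) = √(α ^ 2 - ω ^ 2) / α := by
  have hα0 : 0 < α := hω.trans hα
  rw [θ, Real.sin_arccos]
  have e : 1 - (s * ω / α) ^ 2 = (α ^ 2 - ω ^ 2) / α ^ 2 := by
    have : s ^ 2 = 1 := by rcases hs with rfl | rfl <;> norm_num
    rw [div_pow, mul_pow, this]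
    field_simp
  rw [e, Real.sqrt_div' _ (by positivity), Real.sqrt_sq hα0.le]

theorem sqrt_sq_sub_sq_pos (hω : 0 < ω) (hα : ω < α) : 0 < √(α ^ 2 - ω ^ 2) :=
  Real.sqrt_pos.2 (by nlinarith)

theorem sin_θ_ne_zero (hω : 0 < ω) (hα : ω < α) (hs : s = 1 ∨ s = -1) :
    Real.sin (θ α ω s) ≠ 0 := by
  rw [sin_θ hω hα hs]
  exact (div_pos (sqrt_sq_sub_sq_pos hω hα) (hω.trans hα)).ne'

theorem lam_mul_sin_θ (hω : 0 < ω) (hα : ω < α) (hs : s = 1 ∨ s = -1) :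
    2 * ω * (s * lam α ω) * Real.sin (θ α ω s) = Real.cos (θ α ω s) := by
  rw [cos_θ hω hα hs, sin_θ hω hα hs, lam]
  have h1 := (sqrt_sq_sub_sq_pos hω hα).ne'
  have h2 := (hω.trans hα).ne'
  field_simp

theorem trialSol_eq_phase (E : ℝ) {n : ℕ} (hn : 1 ≤ n) :
    trialSol (θ α ω s) (s * lam α ω) 1 n E = ((n : ℝ) ^ (-(1 / 4) : ℝ) : ℝ) *
      Complex.exp (Complex.I * ((1 * phase α ω s E n : ℝ) : ℂ)) := by
  have hn0 : (0 : ℝ) < n := by exact_mod_cast hn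
  rw [trialSol, Real.rpow_def_of_pos hn0, Complex.ofReal_exp, ← Complex.exp_add, trialExp, phase]
  congr 1
  push_cast
  ring

theorem inv_sqrt_eq_rpow {n : ℕ} (hn : 1 ≤ n) :
    1 / √(n : ℝ) = (n : ℝ) ^ (-(1 / 4) : ℝ) * (n : ℝ) ^ (-(1 / 4) : ℝ) := by
  have hn0 : (0 : ℝ) < n := by exact_mod_cast hn
  rw [← Real.rpow_add hn0, Real.sqrt_eq_rpow, one_div, ← Real.rpow_neg hn0.le]
  norm_num

theorem sqrt_sqrt_eq_rpow (n : ℕ) : √√(n : ℝ) = (n : ℝ) ^ (1 / 4 : ℝ) := by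
  rw [Real.sqrt_eq_rpow, Real.sqrt_eq_rpow, ← Real.rpow_mul (by positivity)]
  norm_num

/-- Only the tail `n ≥ N` is built here, with one `N` for all energies near `E₀`; hence nothing is
required of `E₀`. The factor `(2ω)^{1/4}/v_n(0) ∼ n^{-1/4}` turns the decay `n^{-1/4}` of the
reduced solution into `n^{-1/2}`. -/
theorem exists_normal_solution_near (hω : 0 < ω) (hα : ω < α) (hs : s = 1 ∨ s = -1) (E₀ : ℝ) :
    ∃ (N : ℕ) (c : ℕ → ℝ → ℂ), (∀ n ≥ N, ContDiffAt ℝ 1 (c n) E₀) ∧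
      ∀ᶠ E in 𝓝 E₀, (∀ n ≥ N, (h₂ α ω n E : ℂ) * c (n + 2) E +
        (s : ℂ) * (h₁ ω n E : ℂ) * c (n + 1) E + (h₀ α ω n E : ℂ) * c n E = 0) ∧
      (fun n : ℕ => c n E - ((1 / √(n : ℝ) : ℝ) : ℂ) *
        Complex.exp (Complex.I * ((1 * phase α ω s E n : ℝ) : ℂ)))
        =O[atTop] fun n : ℕ => (n : ℝ) ^ (-(3 / 2) : ℝ) := by
  obtain ⟨V, hVo, hEV, N₁, Y, hYd, hYr, hYa⟩ := exists_reduced_solution_near hω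
    (lam_mul_sin_θ hω hα hs) (sin_θ_ne_zero hω hα hs) E₀
  obtain ⟨N₂, hN₂⟩ := exists_forall_waveNumberSq_neg hω (E₀ + 1)
  refine ⟨max N₁ N₂, fun n E => (√√(2 * ω) : ℂ) / (v ω n E 0 : ℂ) * Y n E, ?_, ?_⟩
  · intro n hn
    have hneg := hN₂ n (le_of_max_le_right hn) E₀ (by linarith)
    have hv : ContDiffAt ℝ 1 (fun E : ℝ => (v ω n E 0 : ℂ)) E₀ :=
      Complex.ofRealCLM.contDiff.contDiffAt.comp E₀ (contDiffAt_v_zero hneg.ne)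
    have hv0 : (v ω n E₀ 0 : ℂ) ≠ 0 := by exact_mod_cast (v_zero_pos_of_neg hneg).ne'
    have hY : ContDiffAt ℝ 1 (fun E : ℝ => Y n E) E₀ := by
      have h1 : ContDiffAt ℝ 1 (Y n) (E₀ : ℂ) :=
        (((hYd n).contDiffOn hVo).contDiffAt (hVo.mem_nhds hEV)).restrict_scalars ℝ
      exact h1.comp E₀ Complex.ofRealCLM.contDiff.contDiffAt
    exact (contDiffAt_const.mul (hv.inv hv0)).mul hY
  · have hV : ∀ᶠ E : ℝ in 𝓝 E₀, (E : ℂ) ∈ V :=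
      Complex.continuous_ofReal.continuousAt.preimage_mem_nhds (hVo.mem_nhds hEV)
    filter_upwards [hV, eventually_lt_nhds (show E₀ < E₀ + 1 by linarith)] with E hE hE1
    refine ⟨fun n hn => ?_, ?_⟩
    · have hn2 : N₂ ≤ n := le_of_max_le_right hn
      exact recurrence_of_reduced hω (hω.trans hα).ne' (cos_θ hω hα hs) (hN₂ n hn2 E hE1)
        (hN₂ (n + 1) (by omega) E hE1) (hN₂ (n + 2) (by omega) E hE1) _ (y := fun n => Y n E)
        (hYr n (le_of_max_le_left hn) E hE)
    · have hr := v_zero_isBigO hω E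
      have hr1 : Tendsto (fun n : ℕ => √√(2 * ω) * √√(n : ℝ) / v ω n E 0) atTop (𝓝 1) := by
        simpa using (hr.trans_tendsto tendsto_inv_atTop_nhds_zero_nat).add_const 1
      have hrC : (fun n : ℕ => ((√√(2 * ω) * √√(n : ℝ) / v ω n E 0 - 1 : ℝ) : ℂ)) =O[atTop]
          fun n : ℕ => (n : ℝ)⁻¹ := by
        refine IsBigO.trans (IsBigO.of_bound 1 (Eventually.of_forall fun n => ?_)) hr
        rw [Complex.norm_real, one_mul]
      have hrC1 : (fun n : ℕ => ((√√(2 * ω) * √√(n : ℝ) / v ω n E 0 : ℝ) : ℂ)) =O[atTop]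
          fun _ => (1 : ℝ) := by
        refine IsBigO.trans (IsBigO.of_bound 1 (Eventually.of_forall fun n => ?_))
          (hr1.isBigO_one ℝ)
        rw [Complex.norm_real, one_mul]
      have hu : (fun n : ℕ => trialSol (θ α ω s) (s * lam α ω) 1 n E) =O[atTop]
          fun n : ℕ => (n : ℝ) ^ (-(1 / 4) : ℝ) := by
        refine IsBigO.of_bound 1 ?_
        filter_upwards [eventually_ge_atTop 1] with n hn
        rw [norm_trialSol_ofReal 1 hn, one_mul]
        exact le_abs_self _
      have hq : (fun n : ℕ => (((n : ℝ) ^ (-(1 / 4) : ℝ) : ℝ) : ℂ)) =O[atTop]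
          fun n : ℕ => (n : ℝ) ^ (-(1 / 4) : ℝ) :=
        IsBigO.of_bound 1 (Eventually.of_forall fun n => by rw [Complex.norm_real, one_mul])
      have hsum := hq.mul ((hrC.mul hu).add
        ((hrC1.mul (hYa E hE)).congr_right fun n => one_mul _))
      refine hsum.congr' ?_ ?_
      · filter_upwards [eventually_ge_atTop 1] with n hn
        have hn0 : (0 : ℝ) < n := by exact_mod_cast hn
        have hx : (n : ℝ) ^ (-(1 / 4) : ℝ) * √√(n : ℝ) = 1 := by
          rw [sqrt_sqrt_eq_rpow, ← Real.rpow_add hn0]; norm_num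
        have hx' : (((n : ℝ) ^ (-(1 / 4) : ℝ) : ℝ) : ℂ) * (√√(n : ℝ) : ℂ) = 1 := by
          exact_mod_cast hx
        rw [inv_sqrt_eq_rpow hn, trialSol_eq_phase E hn]
        set q : ℂ := (((n : ℝ) ^ (-(1 / 4) : ℝ) : ℝ) : ℂ)
        simp only [Complex.ofReal_mul, Complex.ofReal_div, Complex.ofReal_sub, Complex.ofReal_one]
        linear_combination ((√√(2 * ω) : ℂ) / (v ω n E 0 : ℂ) * Y n E) * hx'
      · filter_upwards [eventually_ge_atTop 1] with n hn
        have hn0 : (0 : ℝ) < n := by exact_mod_cast hn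
        rw [← Real.rpow_neg_one, ← Real.rpow_add hn0, ← Real.rpow_add hn0]
        norm_num

theorem IsSolution.linear_combination {E : ℝ} {c d : ℕ → ℂ} (hc : IsSolution α ω s E c)
    (hd : IsSolution α ω s E d) (a b : ℂ) : IsSolution α ω s E fun n => a * c n + b * d n :=
  fun n => by linear_combination a * hc n + b * hd n

theorem IsSolution.conj {E : ℝ} {c : ℕ → ℂ} (hc : IsSolution α ω s E c) :
    IsSolution α ω s E fun n => conj (c n) := fun n => by
  simpa using congrArg conj (hc n)

theorem IsNormalSolution.conj {E τ : ℝ} {c : ℕ → ℂ} (hc : IsNormalSolution α ω s τ E c) :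
    IsNormalSolution α ω s (-τ) E fun n => conj (c n) := by
  refine ⟨hc.1.conj, (IsBigO.of_bound 1 (Eventually.of_forall fun n => ?_)).trans hc.2⟩
  rw [one_mul, ← Complex.norm_conj]
  refine le_of_eq (congrArg _ ?_)
  simp [← Complex.exp_conj]

theorem exists_normal_solution {E : ℝ}
    (hE : E ∉ exceptionalEnergies α ω) {N : ℕ} {c : ℕ → ℂ}
    (hc : ∀ n ≥ N, (h₂ α ω n E : ℂ) * c (n + 2) +
        (s : ℂ) * (h₁ ω n E : ℂ) * c (n + 1) + (h₀ α ω n E : ℂ) * c n = 0)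
    (ha : (fun n : ℕ => c n - ((1 / √(n : ℝ) : ℝ) : ℂ) *
        Complex.exp (Complex.I * ((1 * phase α ω s E n : ℝ) : ℂ)))
        =O[atTop] fun n : ℕ => (n : ℝ) ^ (-(3 / 2) : ℝ)) :
    ∃ C, IsNormalSolution α ω s 1 E C ∧ ∀ n ≥ N, C n = c n := by
  obtain ⟨C, h1, h2⟩ := exists_backward_extension (p := fun n => (h₂ α ω n E : ℂ))
    (q := fun n => (s : ℂ) * (h₁ ω n E : ℂ)) (r := fun n => (h₀ α ω n E : ℂ))
    (fun n => by exact_mod_cast h₀_ne_zero hE n) N c hc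
  refine ⟨C, ⟨h1, ha.congr' ?_ EventuallyEq.rfl⟩, h2⟩
  filter_upwards [eventually_ge_atTop N] with n hn
  rw [h2 n hn]

/-- Eliminating the middle term multiplies the Casoratian by `h₀(n)/h₂(n)` up to sign conventions
absorbed in its orientation; the weight is the one whose ratio compensates this. The argument is
free of division, so vanishing `v_n(0)` do no harm. -/
theorem casoratian_const {E : ℝ} (hα : α ≠ 0) {c d : ℕ → ℂ} (hc : IsSolution α ω s E c)
    (hd : IsSolution α ω s E d) (n : ℕ) :
    (√((n : ℝ) + 1) * v ω (n + 1 : ℕ) E 0 * v ω n E 0 : ℝ) * (c (n + 1) * d n - c n * d (n + 1)) =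
      (v ω (1 : ℕ) E 0 * v ω (0 : ℕ) E 0 : ℝ) * (c 1 * d 0 - c 0 * d 1) := by
  induction n with
  | zero => simp
  | succ n ih =>
    rw [← ih]
    have e2 : h₂ α ω n E = α * √((n : ℝ) + 2) * v ω (n + 2 : ℕ) E 0 := by simp [h₂]
    have e0 : h₀ α ω n E = α * √((n : ℝ) + 1) * v ω n E 0 := by simp [h₀]
    have h1 := hc n
    have h2 := hd n
    rw [e2, e0] at h1 h2
    have hα' : (α : ℂ) ≠ 0 := by exact_mod_cast hα
    have e3 : ((n + 1 : ℕ) : ℝ) + 1 = (n : ℝ) + 2 := by push_cast; ring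
    rw [e3]
    apply mul_left_cancel₀ hα'
    simp only [Complex.ofReal_mul] at h1 h2 ⊢
    linear_combination (v ω (n + 1 : ℕ) E 0 : ℂ) * (d (n + 1) * h1 - c (n + 1) * h2)

/-- The weight in `casoratian_const` is asymptotic to `√(2ω) √(n+1) √n`, so the conserved quantity
is visible in the sequences rescaled by `√n`. -/
theorem casoratian_eq_limit (hω : 0 < ω) {E : ℝ} (hα : α ≠ 0) {c d : ℕ → ℂ}
    (hc : IsSolution α ω s E c) (hd : IsSolution α ω s E d) {L : ℂ}
    (h : Tendsto (fun n : ℕ => ((√((n + 1 : ℕ) : ℝ) : ℂ) * c (n + 1)) * ((√(n : ℝ) : ℂ) * d n) -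
      ((√(n : ℝ) : ℂ) * c n) * ((√((n + 1 : ℕ) : ℝ) : ℂ) * d (n + 1))) atTop (𝓝 L)) :
    (v ω (1 : ℕ) E 0 * v ω (0 : ℕ) E 0 : ℝ) * (c 1 * d 0 - c 0 * d 1) = √(2 * ω) * L := by
  set w := (v ω (1 : ℕ) E 0 * v ω (0 : ℕ) E 0 : ℝ) * (c 1 * d 0 - c 0 * d 1) with hw
  let r : ℕ → ℝ := fun n => √√(2 * ω) * √√(n : ℝ) / v ω n E 0
  have hr1 : Tendsto r atTop (𝓝 1) := by
    have := ((v_zero_isBigO hω E).trans_tendsto tendsto_inv_atTop_nhds_zero_nat).add_const 1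
    simp only [sub_add_cancel, zero_add] at this
    exact this
  have hq : Tendsto (fun n : ℕ => √√(1 + (n : ℝ)⁻¹)) atTop (𝓝 1) := by
    have h1 : Tendsto (fun n : ℕ => 1 + (n : ℝ)⁻¹) atTop (𝓝 1) := by
      simpa using (tendsto_inv_atTop_nhds_zero_nat (𝕜 := ℝ)).const_add 1
    simpa using h1.sqrt.sqrt
  obtain ⟨N, hN⟩ := exists_forall_waveNumberSq_neg hω (E + 1)
  have hl : Tendsto (fun n : ℕ => w * ((r (n + 1) * r n : ℝ) : ℂ)) atTop (𝓝 (w * ((1 * 1 : ℝ) : ℂ))) :=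
    (((hr1.comp (tendsto_add_atTop_nat 1)).mul hr1).ofReal).const_mul w
  have hR : Tendsto (fun n : ℕ => ((√(2 * ω) * √√(1 + (n : ℝ)⁻¹) : ℝ) : ℂ) *
      (((√((n + 1 : ℕ) : ℝ) : ℂ) * c (n + 1)) * ((√(n : ℝ) : ℂ) * d n) -
      ((√(n : ℝ) : ℂ) * c n) * ((√((n + 1 : ℕ) : ℝ) : ℂ) * d (n + 1)))) atTop
      (𝓝 (((√(2 * ω) * 1 : ℝ) : ℂ) * L)) :=
    ((hq.const_mul (√(2 * ω))).ofReal).mul h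
  have heq := tendsto_nhds_unique (hl.congr' ?_) hR
  · simpa using heq
  · filter_upwards [eventually_ge_atTop (N + 1)] with n hn
    have v0 := v_zero_pos_of_neg (hN n (by omega) E (by linarith))
    have v1 := v_zero_pos_of_neg (hN (n + 1) (by omega) E (by linarith))
    have hn0 : (0 : ℝ) < n := by exact_mod_cast (show 0 < n by omega)
    have hq : √√((n : ℝ) + 1) = √√(n : ℝ) * √√(1 + (n : ℝ)⁻¹) := by
      rw [← Real.sqrt_mul (by positivity), ← Real.sqrt_mul (by positivity)]
      congr 2
      field_simp
    have e : (√((n : ℝ) + 1) * v ω (n + 1 : ℕ) E 0 * v ω n E 0) * (r (n + 1) * r n) =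
        √(2 * ω) * √√(1 + (n : ℝ)⁻¹) * √((n + 1 : ℕ) : ℝ) * √(n : ℝ) := by
      simp only [r]
      push_cast
      rw [hq]
      push_cast at v1
      field_simp
      rw [Real.sq_sqrt (by positivity), Real.sq_sqrt (by positivity)]
    rw [hw, ← casoratian_const hα hc hd n]
    have e' := congrArg (fun x : ℝ => (x : ℂ)) e
    simp only [Complex.ofReal_mul] at e' ⊢
    linear_combination (c (n + 1) * d n - c n * d (n + 1)) * e'

theorem tendsto_sqrt_mul_of_isBigO {x : ℕ → ℂ}
    (h : x =O[atTop] fun n : ℕ => (n : ℝ) ^ (-(3 / 2) : ℝ)) :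
    Tendsto (fun n : ℕ => (√(n : ℝ) : ℂ) * x n) atTop (𝓝 0) := by
  have h1 : (fun n : ℕ => (√(n : ℝ) : ℂ)) =O[atTop] fun n : ℕ => √(n : ℝ) :=
    IsBigO.of_bound 1 (Eventually.of_forall fun n => by rw [Complex.norm_real, one_mul])
  refine ((h1.mul h).congr' EventuallyEq.rfl ?_).trans_tendsto
    (tendsto_inv_atTop_nhds_zero_nat (𝕜 := ℝ))
  filter_upwards [eventually_ge_atTop 1] with n hn
  have hn0 : (0 : ℝ) < n := by exact_mod_cast hn
  rw [Real.sqrt_eq_rpow, ← Real.rpow_add hn0, ← Real.rpow_neg_one]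
  norm_num

theorem IsNormalSolution.tendsto {E τ : ℝ} {c : ℕ → ℂ} (hc : IsNormalSolution α ω s τ E c) :
    Tendsto (fun n : ℕ => (√(n : ℝ) : ℂ) * c n -
      Complex.exp (Complex.I * ((τ * phase α ω s E n : ℝ) : ℂ))) atTop (𝓝 0) := by
  refine (tendsto_sqrt_mul_of_isBigO hc.2).congr' ?_
  filter_upwards [eventually_ge_atTop 1] with n hn
  have hn0 : (0 : ℝ) < n := by exact_mod_cast hn
  have : (√(n : ℝ) : ℂ) ≠ 0 := by exact_mod_cast (Real.sqrt_pos.2 hn0).ne'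
  push_cast
  field_simp

theorem norm_exp_I_mul_ofReal (x : ℝ) : ‖Complex.exp (Complex.I * (x : ℂ))‖ = 1 := by
  rw [mul_comm]; exact Complex.norm_exp_ofReal_mul_I x

theorem IsNormalSolution.isBigO_one {E τ : ℝ} {c : ℕ → ℂ} (hc : IsNormalSolution α ω s τ E c) :
    (fun n : ℕ => (√(n : ℝ) : ℂ) * c n) =O[atTop] fun _ => (1 : ℂ) := by
  have h1 : (fun n : ℕ => Complex.exp (Complex.I * ((τ * phase α ω s E n : ℝ) : ℂ))) =O[atTop]
      fun _ => (1 : ℂ) :=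
    IsBigO.of_bound 1 (Eventually.of_forall fun n => by rw [norm_exp_I_mul_ofReal]; simp)
  exact ((hc.tendsto.isBigO_one ℂ).add h1).congr_left fun n => by ring

theorem casoratian_normal_ne_zero (hω : 0 < ω) (hα : ω < α) (hs : s = 1 ∨ s = -1) {E : ℝ}
    {c d : ℕ → ℂ} (hc : IsNormalSolution α ω s 1 E c) (hd : IsNormalSolution α ω s (-1) E d) :
    c 1 * d 0 - c 0 * d 1 ≠ 0 := by
  set e : ℝ → ℕ → ℂ := fun τ n => Complex.exp (Complex.I * ((τ * phase α ω s E n : ℝ) : ℂ)) with he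
  have e1 : ∀ τ, (fun n => e τ n) =O[atTop] fun _ => (1 : ℂ) := fun τ =>
    IsBigO.of_bound 1 (Eventually.of_forall fun n => by rw [he, norm_exp_I_mul_ofReal]; simp)
  have hprod : ∀ {x y x' y' : ℕ → ℂ}, Tendsto (fun n => x n - x' n) atTop (𝓝 0) →
      Tendsto (fun n => y n - y' n) atTop (𝓝 0) → x =O[atTop] (fun _ => (1 : ℂ)) →
      y' =O[atTop] (fun _ => (1 : ℂ)) → Tendsto (fun n => x n * y n - x' n * y' n) atTop (𝓝 0) := by
    intro x y x' y' hx hy hx1 hy1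
    have h1 := (hx1.mul_isLittleO ((isLittleO_one_iff ℂ).2 hy)).add
      (((isLittleO_one_iff ℂ).2 hx).mul_isBigO hy1)
    simp only [mul_one] at h1
    exact ((isLittleO_one_iff ℂ).1 h1).congr fun n => by ring
  have s1 := tendsto_add_atTop_nat 1
  have A := hprod (hc.tendsto.comp s1) hd.tendsto (hc.isBigO_one.comp_tendsto s1) (e1 (-1))
  have B := hprod hc.tendsto (hd.tendsto.comp s1) hc.isBigO_one ((e1 (-1)).comp_tendsto s1)
  -- The logarithmic part of the phase has increments tending to zero, so the limit of the
  -- Casoratian is `2i sin θ`.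
  have hstep : ∀ τ : ℝ, Tendsto (fun n : ℕ => Complex.exp (Complex.I *
      ((τ * (phase α ω s E (n + 1) - phase α ω s E n) : ℝ) : ℂ))) atTop
      (𝓝 (Complex.exp (Complex.I * ((τ * θ α ω s : ℝ) : ℂ)))) := by
    intro τ
    have h1 : Tendsto (fun n : ℕ => τ * (phase α ω s E (n + 1) - phase α ω s E n)) atTop
        (𝓝 (τ * θ α ω s)) := by
      have := ((Real.tendsto_log_nat_add_one_sub_log.const_mul (s * lam α ω * E)).const_add
        (θ α ω s)).const_mul τ
      rw [mul_zero, add_zero] at this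
      refine this.congr fun n => ?_
      simp only [phase]
      push_cast
      ring
    exact (Complex.continuous_exp.tendsto _).comp (h1.ofReal.const_mul Complex.I)
  have D := ((hstep 1).sub (hstep (-1)))
  have T := ((A.sub B).add D)
  have hlim : Complex.exp (Complex.I * ((1 * θ α ω s : ℝ) : ℂ)) -
      Complex.exp (Complex.I * ((-1 * θ α ω s : ℝ) : ℂ)) = 2 * Real.sin (θ α ω s) * Complex.I := by
    rw [mul_comm Complex.I, mul_comm Complex.I, Complex.exp_mul_I, Complex.exp_mul_I]
    simp
    ring
  rw [sub_zero, zero_add, hlim] at T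
  have key := casoratian_eq_limit hω (hω.trans hα).ne' hc.1 hd.1 (T.congr fun n => ?_)
  · intro h0
    rw [h0, mul_zero] at key
    have h1 : (√(2 * ω) : ℂ) ≠ 0 := by
      exact_mod_cast (Real.sqrt_pos.2 (show 0 < 2 * ω by positivity)).ne'
    have h2 : (Real.sin (θ α ω s) : ℂ) ≠ 0 := by exact_mod_cast sin_θ_ne_zero hω hα hs
    exact mul_ne_zero h1 (mul_ne_zero (mul_ne_zero two_ne_zero h2) Complex.I_ne_zero) key.symm
  · have p1 : e 1 (n + 1) * e (-1) n = Complex.exp (Complex.I *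
        ((1 * (phase α ω s E (n + 1) - phase α ω s E n) : ℝ) : ℂ)) := by
      simp only [he]; rw [← Complex.exp_add]; congr 1; push_cast; ring
    have p2 : e 1 n * e (-1) (n + 1) = Complex.exp (Complex.I *
        ((-1 * (phase α ω s E (n + 1) - phase α ω s E n) : ℝ) : ℂ)) := by
      simp only [he]; rw [← Complex.exp_add]; congr 1; push_cast; ring
    rw [← p1, ← p2]
    simp only [he]
    ring

/-- The difference `f` is `o(n^{-1/2})`, so its Casoratians with `c` and with the conjugate of `c`
both vanish. These are two linear equations for `f 0`, `f 1` with nonzero determinant. -/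
theorem eq_of_isNormalSolution (hω : 0 < ω) (hα : ω < α) (hs : s = 1 ∨ s = -1) {E : ℝ}
    (hE : E ∉ exceptionalEnergies α ω) {c d : ℕ → ℂ} (hc : IsNormalSolution α ω s 1 E c)
    (hd : IsNormalSolution α ω s 1 E d) : c = d := by
  set f : ℕ → ℂ := fun n => 1 * d n + (-1) * c n with hf
  have hfs : IsSolution α ω s E f := hd.1.linear_combination hc.1 1 (-1)
  have hf0 : Tendsto (fun n : ℕ => (√(n : ℝ) : ℂ) * f n) atTop (𝓝 0) :=
    tendsto_sqrt_mul_of_isBigO ((hd.2.sub hc.2).congr_left fun n => by simp only [hf]; ring)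
  have hvv : ((v ω (1 : ℕ) E 0 * v ω (0 : ℕ) E 0 : ℝ) : ℂ) ≠ 0 := by
    have := (notMem_exceptionalEnergies_iff hω hα).1 hE
    exact_mod_cast mul_ne_zero (this 1).1 (this 0).1
  have key : ∀ {τ : ℝ} {g : ℕ → ℂ}, IsNormalSolution α ω s τ E g → g 1 * f 0 - g 0 * f 1 = 0 := by
    intro τ g hg
    have s1 := tendsto_add_atTop_nat 1
    have h1 := ((hg.isBigO_one.comp_tendsto s1).mul_isLittleO ((isLittleO_one_iff ℂ).2 hf0)).sub
      (hg.isBigO_one.mul_isLittleO ((isLittleO_one_iff ℂ).2 (hf0.comp s1)))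
    have h2 := casoratian_eq_limit hω (hω.trans hα).ne' hg.1 hfs (L := 0)
      ((isLittleO_one_iff ℂ).1 (by simpa [Function.comp_def] using h1))
    rw [mul_zero] at h2
    exact (mul_eq_zero.1 h2).resolve_left hvv
  have k1 := key hc
  have k2 := key hc.conj
  have hne := casoratian_normal_ne_zero hω hα hs hc hc.conj
  have f0 : f 0 = 0 := by
    refine (mul_eq_zero.1 (?_ : (c 1 * conj (c 0) - c 0 * conj (c 1)) * f 0 = 0)).resolve_left hne
    linear_combination conj (c 0) * k1 - c 0 * k2
  have f1 : f 1 = 0 := by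
    refine (mul_eq_zero.1 (?_ : (c 1 * conj (c 0) - c 0 * conj (c 1)) * f 1 = 0)).resolve_left hne
    linear_combination conj (c 1) * k1 - c 1 * k2
  funext n
  refine eq_of_recurrence (fun n => ?_) hc.1 hd.1 ?_ ?_ n
  · exact_mod_cast h₂_ne_zero hE n
  · linear_combination -f0
  · linear_combination -f1

end
end OscillatorRing

/-! ### Smooth dependence on the energy and the amplitude `Z`. -/

namespace OscillatorRing
open Filter Topology Asymptotics
open scoped ComplexConjugate

noncomputable section

variable {α ω s : ℝ}

theorem existsUnique_normal_solution (hω : 0 < ω) (hα : ω < α) (hs : s = 1 ∨ s = -1) {E : ℝ}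
    (hE : E ∉ exceptionalEnergies α ω) : ∃! c, IsNormalSolution α ω s 1 E c := by
  obtain ⟨N, c, -, hc⟩ := exists_normal_solution_near hω hα hs E
  obtain ⟨C, hC, -⟩ := exists_normal_solution hE hc.self_of_nhds.1 hc.self_of_nhds.2
  exact ⟨C, hC, fun d hd => eq_of_isNormalSolution hω hα hs hE hd hC⟩

open Classical in
/-- The normal solution with sign `+1`. -/
def normalSol (α ω s : ℝ) (n : ℕ) (E : ℝ) : ℂ :=
  if h : ∃ c, IsNormalSolution α ω s 1 E c then h.choose n else 0

theorem isNormalSolution_normalSol (hω : 0 < ω) (hα : ω < α) (hs : s = 1 ∨ s = -1) {E : ℝ}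
    (hE : E ∉ exceptionalEnergies α ω) :
    IsNormalSolution α ω s 1 E fun n => normalSol α ω s n E := by
  have h := (existsUnique_normal_solution hω hα hs hE).exists
  simp only [normalSol, dif_pos h]
  exact h.choose_spec

/-- By uniqueness the normal solution agrees near `E₀` with the smooth local family for `n ≥ N`;
smaller `n` follow by solving the recurrence for its last term, where `h₀ ≠ 0`. -/
theorem contDiffAt_normalSol (hω : 0 < ω) (hα : ω < α) (hs : s = 1 ∨ s = -1) {E₀ : ℝ}
    (hE₀ : E₀ ∉ exceptionalEnergies α ω) (n : ℕ) : ContDiffAt ℝ 1 (normalSol α ω s n) E₀ := by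
  obtain ⟨N, c, hcd, hc⟩ := exists_normal_solution_near hω hα hs E₀
  have hS : ∀ᶠ E in 𝓝 E₀, E ∉ exceptionalEnergies α ω :=
    (isOpen_compl_exceptionalEnergies hω hα).mem_nhds hE₀
  -- Here `k` bounds how far `n` lies below `N`, which makes the descent an ordinary induction.
  have key : ∀ k n, N ≤ n + k → ContDiffAt ℝ 1 (normalSol α ω s n) E₀ := by
    intro k
    induction k with
    | zero =>
      intro n hn
      refine (hcd n hn).congr_of_eventuallyEq ?_
      filter_upwards [hc, hS] with E hE hES
      obtain ⟨C, hC, hCc⟩ := exists_normal_solution hES hE.1 hE.2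
      rw [← hCc n hn]
      exact congrFun (eq_of_isNormalSolution hω hα hs hES
        (isNormalSolution_normalSol hω hα hs hES) hC) n
    | succ k ih =>
      intro n hn
      have hof : ∀ {f : ℝ → ℝ}, ContDiffAt ℝ 1 f E₀ → ContDiffAt ℝ 1 (fun E => (f E : ℂ)) E₀ :=
        fun hf => Complex.ofRealCLM.contDiff.contDiffAt.comp E₀ hf
      have d2 := hof (contDiffAt_h₂ hω hα hE₀ (show (-1 : ℤ) ≤ n by omega))
      have d1 := hof (contDiffAt_h₁ hω hα hE₀ (show (-1 : ℤ) ≤ n by omega))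
      have d0 := hof (contDiffAt_h₀ hω hα hE₀ n)
      have h0 : (h₀ α ω n E₀ : ℂ) ≠ 0 := by exact_mod_cast h₀_ne_zero hE₀ n
      refine (((d2.mul (ih (n + 2) (by omega))).add ((contDiffAt_const (c := (s : ℂ)).mul d1).mul
        (ih (n + 1) (by omega)))).neg.mul (d0.inv h0)).congr_of_eventuallyEq ?_
      filter_upwards [hS] with E hE
      have h0 : (h₀ α ω n E : ℂ) ≠ 0 := by exact_mod_cast h₀_ne_zero hE n
      have := (isNormalSolution_normalSol hω hα hs hE).1 n
      simp only [Pi.inv_apply]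
      rw [eq_mul_inv_iff_mul_eq₀ h0]
      linear_combination this
  exact key N n (Nat.le_add_left _ _)

/-- `C(1)` for the solution with `C(0) = 1` that meets the initial condition. -/
def initialSlope (α ω s E : ℝ) : ℝ := -(s * h₁ ω (-1) E) / h₂ α ω (-1) E

/-- The Casoratian of the two normal solutions at `0`. -/
def normalCasoratian (α ω s E : ℝ) : ℂ :=
  normalSol α ω s 1 E * conj (normalSol α ω s 0 E) -
    normalSol α ω s 0 E * conj (normalSol α ω s 1 E)

/-- The amplitude of the solution that meets the initial condition. -/
def amplitude (α ω s E : ℝ) : ℂ :=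
  2 * (initialSlope α ω s E * conj (normalSol α ω s 0 E) - conj (normalSol α ω s 1 E)) *
    (normalCasoratian α ω s E)⁻¹

section Amplitude

variable {E : ℝ}

theorem normalCasoratian_ne_zero (hω : 0 < ω) (hα : ω < α) (hs : s = 1 ∨ s = -1)
    (hE : E ∉ exceptionalEnergies α ω) : normalCasoratian α ω s E ≠ 0 :=
  casoratian_normal_ne_zero hω hα hs (isNormalSolution_normalSol hω hα hs hE)
    (isNormalSolution_normalSol hω hα hs hE).conj

/-- The Casoratian of a sequence with its conjugate is purely imaginary; this is the sign. Hence
`Z/2` and its conjugate are the Cramer coefficients for the data `1` and `initialSlope` at `n = 0,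
1`. -/
theorem conj_amplitude :
    conj (amplitude α ω s E) =
      -(2 * (initialSlope α ω s E * normalSol α ω s 0 E - normalSol α ω s 1 E) *
        (normalCasoratian α ω s E)⁻¹) := by
  have hc : conj (normalCasoratian α ω s E) = -normalCasoratian α ω s E := by
    simp only [normalCasoratian, map_sub, map_mul, Complex.conj_conj]
    ring
  simp only [amplitude, map_mul, map_sub, map_inv₀, Complex.conj_conj, Complex.conj_ofReal, hc,
    map_ofNat]
  rw [inv_neg]
  ring

theorem re_amplitude_mul (n : ℕ) :
    (((amplitude α ω s E * normalSol α ω s n E).re : ℝ) : ℂ) =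
      amplitude α ω s E / 2 * normalSol α ω s n E +
        conj (amplitude α ω s E) / 2 * conj (normalSol α ω s n E) := by
  rw [Complex.re_eq_add_conj, map_mul]
  ring

theorem re_amplitude_mul_zero (hω : 0 < ω) (hα : ω < α) (hs : s = 1 ∨ s = -1)
    (hE : E ∉ exceptionalEnergies α ω) :
    (amplitude α ω s E * normalSol α ω s 0 E).re = 1 := by
  have hne := normalCasoratian_ne_zero hω hα hs hE
  have h := re_amplitude_mul (α := α) (ω := ω) (s := s) (E := E) 0
  rw [conj_amplitude, amplitude] at h
  have h2 : (((amplitude α ω s E * normalSol α ω s 0 E).re : ℝ) : ℂ) =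
      normalCasoratian α ω s E * (normalCasoratian α ω s E)⁻¹ := by
    rw [amplitude, h]
    -- Only the uninverted factor is unfolded, so that the inverse remains an atom for `ring`.
    nth_rewrite 3 [normalCasoratian]
    ring
  rw [mul_inv_cancel₀ hne] at h2
  exact_mod_cast h2

theorem re_amplitude_mul_one (hω : 0 < ω) (hα : ω < α) (hs : s = 1 ∨ s = -1)
    (hE : E ∉ exceptionalEnergies α ω) :
    (amplitude α ω s E * normalSol α ω s 1 E).re = initialSlope α ω s E := by
  have hne := normalCasoratian_ne_zero hω hα hs hE
  have h := re_amplitude_mul (α := α) (ω := ω) (s := s) (E := E) 1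
  rw [conj_amplitude, amplitude] at h
  have h2 : (((amplitude α ω s E * normalSol α ω s 1 E).re : ℝ) : ℂ) =
      initialSlope α ω s E * (normalCasoratian α ω s E * (normalCasoratian α ω s E)⁻¹) := by
    rw [amplitude, h]
    nth_rewrite 3 [normalCasoratian]
    ring
  rw [mul_inv_cancel₀ hne, mul_one] at h2
  exact_mod_cast h2

theorem amplitude_ne_zero (hω : 0 < ω) (hα : ω < α) (hs : s = 1 ∨ s = -1)
    (hE : E ∉ exceptionalEnergies α ω) : amplitude α ω s E ≠ 0 := by
  intro h
  have := re_amplitude_mul_zero hω hα hs hE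
  simp [h] at this

theorem contDiffAt_amplitude (hω : 0 < ω) (hα : ω < α) (hs : s = 1 ∨ s = -1)
    (hE : E ∉ exceptionalEnergies α ω) : ContDiffAt ℝ 1 (amplitude α ω s) E := by
  have d : ∀ n, ContDiffAt ℝ 1 (normalSol α ω s n) E := contDiffAt_normalSol hω hα hs hE
  have dc : ∀ n, ContDiffAt ℝ 1 (fun E => conj (normalSol α ω s n E)) E := fun n =>
    Complex.conjCLE.contDiff.contDiffAt.comp E (d n)
  have di : ContDiffAt ℝ 1 (fun E => (initialSlope α ω s E : ℂ)) E :=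
    Complex.ofRealCLM.contDiff.contDiffAt.comp E
      ((contDiffAt_const.mul (contDiffAt_h₁ hω hα hE le_rfl)).neg.div
        (contDiffAt_h₂ hω hα hE le_rfl) (h₂_neg_one_ne_zero hω hα hE))
  exact (contDiffAt_const.mul ((di.mul (dc 0)).sub (dc 1))).mul
    ((((d 1).mul (dc 0)).sub ((d 0).mul (dc 1))).inv (normalCasoratian_ne_zero hω hα hs hE))

theorem linearIndependent_normalSol (hω : 0 < ω) (hα : ω < α) (hs : s = 1 ∨ s = -1)
    (hE : E ∉ exceptionalEnergies α ω) :
    LinearIndependent ℂ ![fun n => normalSol α ω s n E, fun n => conj (normalSol α ω s n E)] := by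
  have hne := normalCasoratian_ne_zero hω hα hs hE
  rw [normalCasoratian] at hne
  rw [LinearIndependent.pair_iff]
  intro a b hab
  have h0 : a * normalSol α ω s 0 E + b * conj (normalSol α ω s 0 E) = 0 := by
    simpa using congrFun hab 0
  have h1 : a * normalSol α ω s 1 E + b * conj (normalSol α ω s 1 E) = 0 := by
    simpa using congrFun hab 1
  refine ⟨(mul_eq_zero.1 ?_).resolve_right hne, (mul_eq_zero.1 ?_).resolve_right hne⟩
  · linear_combination conj (normalSol α ω s 0 E) * h1 - conj (normalSol α ω s 1 E) * h0
  · linear_combination normalSol α ω s 1 E * h0 - normalSol α ω s 0 E * h1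

theorem physical_asymptotics {Z : ℂ} (hZ : Z ≠ 0) {ζ : ℝ}
    (hζ : Z = (‖Z‖ : ℂ) * Complex.exp (Complex.I * (ζ : ℂ))) {c : ℕ → ℂ}
    (hc : IsNormalSolution α ω s 1 E c) :
    (fun n : ℕ => 1 / (√Real.pi * ‖Z‖) * (Z * c n).re -
      1 / √(Real.pi * n) * Real.cos (phase α ω s E n + ζ)) =O[atTop]
      fun n : ℕ => (n : ℝ) ^ (-(3 / 2) : ℝ) := by
  have h1 := hc.2.const_mul_left ((1 / (√Real.pi * ‖Z‖) : ℝ) * Z)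
  refine (IsBigO.of_bound 1 (Eventually.of_forall fun n => ?_)).trans h1
  have hZ0 : ‖Z‖ ≠ 0 := norm_ne_zero_iff.2 hZ
  have e : 1 / (√Real.pi * ‖Z‖) * (Z * c n).re -
      1 / √(Real.pi * n) * Real.cos (phase α ω s E n + ζ) =
      (((1 / (√Real.pi * ‖Z‖) : ℝ) * Z) * (c n - ((1 / √(n : ℝ) : ℝ) : ℂ) *
        Complex.exp (Complex.I * ((1 * phase α ω s E n : ℝ) : ℂ)))).re := by
    have e1 : Z * Complex.exp (Complex.I * ((1 * phase α ω s E n : ℝ) : ℂ)) =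
        (‖Z‖ : ℂ) * Complex.exp (((phase α ω s E n + ζ : ℝ) : ℂ) * Complex.I) := by
      nth_rewrite 1 [hζ]
      rw [mul_assoc, ← Complex.exp_add]
      congr 2
      push_cast
      ring
    have e2 : ((1 / (√Real.pi * ‖Z‖) : ℝ) * Z) * (c n - ((1 / √(n : ℝ) : ℝ) : ℂ) *
        Complex.exp (Complex.I * ((1 * phase α ω s E n : ℝ) : ℂ))) =
        ((1 / (√Real.pi * ‖Z‖) : ℝ) : ℂ) * (Z * c n) -
        ((1 / (√Real.pi * ‖Z‖) * (1 / √(n : ℝ)) * ‖Z‖ : ℝ) : ℂ) *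
        Complex.exp (((phase α ω s E n + ζ : ℝ) : ℂ) * Complex.I) := by
      rw [Complex.ofReal_mul _ ‖Z‖, mul_assoc (((1 / (√Real.pi * ‖Z‖) * (1 / √(n : ℝ)) : ℝ)) : ℂ),
        ← e1, Complex.ofReal_mul (1 / (√Real.pi * ‖Z‖)) (1 / √(n : ℝ))]
      ring
    rw [e2, Complex.sub_re, Complex.re_ofReal_mul, Complex.re_ofReal_mul,
      Complex.exp_ofReal_mul_I_re, Real.sqrt_mul Real.pi_pos.le]
    congr 2
    -- At `n = 0` both sides vanish, since division by zero gives zero.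
    rcases eq_or_ne (√(n : ℝ)) 0 with h | h
    · simp [h]
    · field_simp
  rw [e]
  refine le_of_le_of_eq ?_ (one_mul _).symm
  exact Complex.abs_re_le_norm _

end Amplitude
end
end OscillatorRing

/-! ### Assembly of the theorem. -/

open OscillatorRing
theorem mainTheorem7 (α ω s : ℝ) (hω : 0 < ω) (hα : ω < α) (hs : s = 1 ∨ s = -1) :
    ∃ Cp Cm : ℕ → ℝ → ℂ,
      -- the normal solutions exist, are unique, and are linearly independent
      (∀ E ∉ exceptionalEnergies α ω,
        (∀ c : ℕ → ℂ, IsNormalSolution α ω s 1 E c ↔ c = fun n => Cp n E) ∧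
        (∀ c : ℕ → ℂ, IsNormalSolution α ω s (-1) E c ↔ c = fun n => Cm n E) ∧
        LinearIndependent ℂ ![fun n => Cp n E, fun n => Cm n E]) ∧
      -- they are continuously differentiable in the energy
      (∀ I : Set ℝ, IsClosed I → I.OrdConnected → Disjoint I (exceptionalEnergies α ω) →
        ∀ n : ℕ, ContDiffOn ℝ 1 (Cp n) I ∧ ContDiffOn ℝ 1 (Cm n) I) ∧
      -- the solution that meets the initial condition, with amplitude `Z` and phase `ζ`
      ∃ (Z : ℝ → ℂ) (ζ : ℝ → ℝ) (C : ℕ → ℝ → ℝ),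
        (∀ E ∉ exceptionalEnergies α ω,
          IsSolution α ω s E (fun n => (C n E : ℂ)) ∧
          InitialCondition α ω s E (fun n => (C n E : ℂ)) ∧
          ((fun n : ℕ => C n E - 1 / √(Real.pi * n) * Real.cos (phase α ω s E n + ζ E))
            =O[Filter.atTop] fun n : ℕ => (n : ℝ) ^ (-(3 / 2) : ℝ)) ∧
          0 < C 0 E ∧ C 0 E * ‖Z E‖ = 1 / √Real.pi ∧
          (∀ n : ℕ, C n E = C 0 E * (Z E * Cp n E).re) ∧
          Z E = (‖Z E‖ : ℂ) * Complex.exp (Complex.I * (ζ E : ℂ))) ∧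
        (∀ I : Set ℝ, IsClosed I → I.OrdConnected → Disjoint I (exceptionalEnergies α ω) →
          ContDiffOn ℝ 1 Z I ∧ ContDiffOn ℝ 1 ζ I) := by
  have hsub : ∀ I : Set ℝ, Disjoint I (exceptionalEnergies α ω) → ∀ E ∈ I,
      E ∉ exceptionalEnergies α ω := fun I hI E hE h => Set.disjoint_left.1 hI hE h
  have hconj : ∀ n E, E ∉ exceptionalEnergies α ω →
      ContDiffAt ℝ 1 (fun E => starRingEnd ℂ (normalSol α ω s n E)) E := fun n E hE =>
    Complex.conjCLE.contDiff.contDiffAt.comp E (contDiffAt_normalSol hω hα hs hE n)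
  obtain ⟨ζ, hζ, hζZ⟩ := exists_contDiff_arg (isOpen_compl_exceptionalEnergies hω hα)
    (Z := amplitude α ω s)
    (fun E hE => (contDiffAt_amplitude hω hα hs hE).contDiffWithinAt)
    (fun E hE => amplitude_ne_zero hω hα hs hE)
  -- Since `Re(Z C₊(0)) = 1`, the prefactor `1/(√π ‖Z‖)` is the value of the solution at `0`; it
  -- makes the asymptotic amplitude `1/√(πn)`.
  refine ⟨normalSol α ω s, fun n E => starRingEnd ℂ (normalSol α ω s n E), ?_, ?_,
    amplitude α ω s, ζ, fun n E => 1 / (√Real.pi * ‖amplitude α ω s E‖) *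
      (amplitude α ω s E * normalSol α ω s n E).re, ?_, ?_⟩
  · intro E hE
    have hn := isNormalSolution_normalSol hω hα hs hE
    refine ⟨fun c => ⟨fun hc => eq_of_isNormalSolution hω hα hs hE hc hn, ?_⟩,
      fun c => ⟨fun hc => ?_, ?_⟩, linearIndependent_normalSol hω hα hs hE⟩
    · rintro rfl
      exact hn
    · have h1 := hc.conj
      rw [neg_neg] at h1
      have h2 := eq_of_isNormalSolution hω hα hs hE h1 hn
      funext n
      exact (Complex.conj_conj (c n)).symm.trans (congrArg _ (congrFun h2 n))
    · rintro rfl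
      exact hn.conj
  · intro I _ _ hI n
    exact ⟨fun E hE => (contDiffAt_normalSol hω hα hs (hsub I hI E hE) n).contDiffWithinAt,
      fun E hE => (hconj n E (hsub I hI E hE)).contDiffWithinAt⟩
  · intro E hE
    have hn := isNormalSolution_normalSol hω hα hs hE
    have hZ := amplitude_ne_zero hω hα hs hE
    have hZ0 : 0 < ‖amplitude α ω s E‖ := norm_pos_iff.2 hZ
    have hpi : 0 < √Real.pi := Real.sqrt_pos.2 Real.pi_pos
    have h0 := re_amplitude_mul_zero hω hα hs hE
    refine ⟨?_, ?_, physical_asymptotics hZ (hζZ E hE) hn, ?_, ?_, fun n => ?_, hζZ E hE⟩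
    -- A real part is half the sum with the conjugate, hence a combination of the two normal
    -- solutions.
    · have := hn.1.linear_combination hn.1.conj
        ((1 / (√Real.pi * ‖amplitude α ω s E‖) : ℝ) * (amplitude α ω s E / 2))
        ((1 / (√Real.pi * ‖amplitude α ω s E‖) : ℝ) * (starRingEnd ℂ (amplitude α ω s E) / 2))
      convert this using 2 with n
      rw [Complex.ofReal_mul, re_amplitude_mul]
      ring
    · beta_reduce
      rw [InitialCondition, h0, re_amplitude_mul_one hω hα hs hE, initialSlope]
      have h2 : (h₂ α ω (-1) E : ℂ) ≠ 0 := by exact_mod_cast h₂_neg_one_ne_zero hω hα hE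
      push_cast
      field_simp
    · beta_reduce
      rw [h0]
      positivity
    · beta_reduce
      rw [h0]
      field_simp
    · beta_reduce
      rw [h0, mul_one]
  · intro I _ _ hI
    exact ⟨fun E hE => (contDiffAt_amplitude hω hα hs (hsub I hI E hE)).contDiffWithinAt,
      hζ.mono (hsub I hI)⟩
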